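/- Let $N_1,N_2\ge 1$ be integers, let $0\le v_1<v_2$, and let $\alpha_{ij}\ge 0$ ($i,j\in\{1,2\}$) be constants with $\alpha_{12}>0$ and $\alpha_{21}>0$ (in particular, $\alpha_{11}=\alpha_{22}=0$ is allowed). Consider $N_1$ particles of type $1$ and $N_2$ particles of type $2$ on the real line; $x_k^{(i)}(t)$ is the coordinate at time $t\ge 0$ of the $k$-th particle of type $i$. Each particle of type $i$ moves with constant velocity $v_i$ and, independently of the others, for each $j$ it jumps at rate $\alpha_{ij}$ to the current position of a particle chosen uniformly among the $N_j$ particles of type $j$; after a jump it keeps its type and velocity. That is, $x(t)=(x_k^{(i)}(t))$ is the Markov process (with right-continuous trajectories) on $\mathbb R^{N_1+N_2}$ with generator $$(Lf)(x)=\sum_{i,k} v_i\,\frac{\partial f}{\partial x_k^{(i)}}(x)+\sum_{i,j}\sum_{k=1}^{N_i}\sum_{l=1}^{N_j}\frac{\alpha_{ij}}{N_j}\bigl[f(x^{(i,k)\to(j,l)})-f(x)\bigr],$$ where $x^{(i,k)\to(j,l)}$ is $x$ with the coordinate $x_k^{(i)}$ replaced by $x_l^{(j)}$. The initial configuration $x(0)$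 is an arbitrary deterministic configuration. Put $m(t)=\min_{i,k}x_k^{(i)}(t)$. Then there are a deterministic constant $v>0$ and a probability measure $\pi$ on $\mathbb R^{N_1+N_2}$, both depending only on $N_1,N_2$, the velocities $v_i$ and the rates $\alpha_{ij}$, and not on the initial configuration, such that for every initial configuration: 1. for every $i\in\{1,2\}$ and every $k=1,\dots,N_i$, almost surely $\displaystyle\lim_{t\to\infty}\frac{x_k^{(i)}(t)}{t}=v$; 2. as $t\to\infty$, the random vector $\{x_k^{(i)}(t)-m(t):\ i=1,2,\ k=1,\dots,N_i\}$ converges in distribution to $\pi$; and $\pi$ is a stationary distribution of the Markov process $\{x_k^{(i)}(t)-m(t)\}$ of configurations seen from the leftmost particle. -/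

import Mathlib

open MeasureTheory ProbabilityTheory Filter Topology
open scoped NNReal

noncomputable section

namespace SyncModel

/-- The particles: `⟨i, k⟩` is the `k`-th particle of type `i`; the two types are indexed
by `0` and `1`, and there are `N i` particles of type `i`. -/
abbrev Particle (N : Fin 2 → ℕ) : Type := (i : Fin 2) × Fin (N i)

/-- A configuration assigns to every particle its coordinate on the line. -/
abbrev Config (N : Fin 2 → ℕ) : Type := Particle N → ℝ

/-- A possible jump `(p, q)`: the particle `p` jumps to the place of the particle `q`. -/
abbrev Jump (N : Fin 2 → ℕ) : Type := Particle N × Particle N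

/-- The configuration after the jump. -/
def applyJump {N : Fin 2 → ℕ} (e : Jump N) (x : Config N) : Config N :=
  Function.update x e.1 (x e.2)

/-- Free motion during time `s`: every particle of type `i` moves with velocity `v i`. -/
def freeMotion {N : Fin 2 → ℕ} (v : Fin 2 → ℝ) (s : ℝ) (x : Config N) : Config N :=
  fun p => x p + v p.1 * s

/-- The rate of the jump of `p` (of type `i`) to `q` (of type `j`) is `α i j / N j`. -/
def jumpRate {N : Fin 2 → ℕ} (α : Fin 2 → Fin 2 → ℝ) (e : Jump N) : ℝ :=
  α e.1.1 e.2.1 / N e.2.1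

/-- The total jump rate, which is the same in all configurations. -/
def totalRate (N : Fin 2 → ℕ) (α : Fin 2 → Fin 2 → ℝ) : ℝ :=
  ∑ e : Jump N, jumpRate α e

/-- The distribution of the next jump: probabilities proportional to the rates. -/
def jumpLaw (N : Fin 2 → ℕ) (α : Fin 2 → Fin 2 → ℝ) : Measure (Jump N) :=
  ∑ e : Jump N, ENNReal.ofReal (jumpRate α e / totalRate N α) • Measure.dirac e

/-- The driving randomness: an i.i.d. sequence of pairs, each consisting of an exponential
waiting time with parameter `totalRate N α` and an independent choice of the jump. -/
def drivingLaw (N : Fin 2 → ℕ) (α : Fin 2 → Fin 2 → ℝ) : Measure (ℕ → ℝ × Jump N) :=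
  Measure.infinitePi fun _ : ℕ => (expMeasure (totalRate N α)).prod (jumpLaw N α)

/-- The time of the `n`-th jump (and `0` for `n = 0`). -/
def jumpTime {N : Fin 2 → ℕ} (ω : ℕ → ℝ × Jump N) (n : ℕ) : ℝ :=
  ∑ k ∈ Finset.range n, (ω k).1

/-- The number of jumps up to time `t`, i.e. the least `n` such that the jump number `n + 1`
happens after time `t`. -/
def jumpCount {N : Fin 2 → ℕ} (ω : ℕ → ℝ × Jump N) (t : ℝ) : ℕ :=
  sInf {n : ℕ | t < jumpTime ω (n + 1)}

/-- The configuration immediately after the `n`-th jump, started from `x` at time `0`. -/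
def configAfter {N : Fin 2 → ℕ} (v : Fin 2 → ℝ) (x : Config N) (ω : ℕ → ℝ × Jump N) :
    ℕ → Config N
  | 0 => x
  | n + 1 => applyJump (ω n).2 (freeMotion v (ω n).1 (configAfter v x ω n))

/-- The configuration at time `t` of the system started from `x`. -/
def path {N : Fin 2 → ℕ} (v : Fin 2 → ℝ) (x : Config N) (ω : ℕ → ℝ × Jump N) (t : ℝ≥0) :
    Config N :=
  freeMotion v (t - jumpTime ω (jumpCount ω t)) (configAfter v x ω (jumpCount ω t))

/-- `X` is a version of the particle process with initial configuration `x`, on the probability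
space `(Ω, μ)`: as a process it has the law of `path v x` (that is, the law of the Markov process
with the generator `f ↦ ∑ p, v p.1 * ∂f/∂x p + ∑ e, jumpRate α e * (f (applyJump e x) - f x)`,
started from `x`), and its trajectories are a.s. right-continuous. -/
structure IsParticleProcess {Ω : Type*} [MeasurableSpace Ω] {N : Fin 2 → ℕ} (v : Fin 2 → ℝ)
    (α : Fin 2 → Fin 2 → ℝ) (x : Config N) (X : ℝ≥0 → Ω → Config N) (μ : Measure Ω) :
    Prop where
  identDistrib : IdentDistrib (fun ω t => X t ω) (fun ω t => path v x ω t) μ (drivingLaw N α)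
  rightContinuous : ∀ᵐ ω ∂μ, ∀ t : ℝ≥0,
    ContinuousWithinAt (fun s : ℝ≥0 => X s ω) (Set.Ici t) t

/-- The configuration seen from its leftmost particle. -/
def fromLeftmost {N : Fin 2 → ℕ} (x : Config N) : Config N :=
  fun p => x p - ⨅ q : Particle N, x q

/-- `π` is a stationary distribution of the Markov process of configurations seen from the
leftmost particle: started at time `0` from a random configuration with law `π`, independent of
the driving randomness, it has the law `π` at every time `t`. -/
def IsStationaryFromLeftmost {N : Fin 2 → ℕ} (v : Fin 2 → ℝ) (α : Fin 2 → Fin 2 → ℝ)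
    (π : Measure (Config N)) : Prop :=
  ∀ t : ℝ≥0, (π.prod (drivingLaw N α)).map (fun z => fromLeftmost (path v z.1 z.2 t)) = π

end SyncModel

end

/-! The argument traces positions backwards. A jump copies one coordinate into another, so after `n`
jumps the particle `p` stands at `x (ancestor ω n p)` plus a displacement determined by the waiting
times and jumps alone (`configAfter_eq`). The ancestor maps are compositions of i.i.d. random
self-maps of a finite set. As `α 0 1` and `α 1 0` are positive, some finite word of jumps has a
constant composition, with a fast particle as its value (`exists_coalescing_jumps`). Independent
blocks of jumps almost surely produce a constant composition sooner or later, and it then stays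
constant (`ae_exists_coalesced`).

Speed: the displacement is the sum of the waiting times, each multiplied by the velocity of the
ancestor during that wait. By coalescence this velocity is, up to an error small on average, a
function of the next `l` terms of the driving sequence only. The strong law applies for each fixed
`l`, and then `l → ∞`. The mean displacement per jump does not depend on `p` or `x`, and it is
positive because the ancestor is fast with positive probability. Division by the mean waiting time
gives the speed (`exists_speed`).

Stationary law: once the ancestor map is constant, two copies driven by the same randomness from
different configurations differ by a translation, which the view from the leftmost particle does not
see (`fromLeftmost_path_congr`). So the law at time `t` depends on the start by at most the
probability of no coalescence by time `t`, uniformly over starts and events. Together with the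
Markov property (`lintegral_path_add`) this uniform forgetting yields a setwise limit which is
invariant (`exists_invariant_of_uniform_forgetting`); no tightness argument is needed.

Both conclusions are first proved for `path` and then carried to an arbitrary version through its
law and right-continuity. -/

namespace SyncModel

/-! ### Shifts of i.i.d. sequences and independence of disjoint blocks -/

section Shift

variable {E : Type*}

/-- The sequence with its first `k` terms removed. -/
def shift (k : ℕ) (ω : ℕ → E) : ℕ → E := fun n => ω (n + k)

/-- The sequence with the first term `a`, followed by `ω`. -/
def seqCons (a : E) (ω : ℕ → E) : ℕ → E
  | 0 => a
  | n + 1 => ω n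

@[simp] lemma shift_apply (k : ℕ) (ω : ℕ → E) (n : ℕ) : shift k ω n = ω (n + k) := rfl

@[simp] lemma shift_zero (ω : ℕ → E) : shift 0 ω = ω := rfl

@[simp] lemma seqCons_zero (a : E) (ω : ℕ → E) : seqCons a ω 0 = a := rfl

@[simp] lemma seqCons_succ (a : E) (ω : ℕ → E) (n : ℕ) : seqCons a ω (n + 1) = ω n := rfl

@[simp] lemma shift_one_seqCons (a : E) (ω : ℕ → E) : shift 1 (seqCons a ω) = ω := rfl

variable [MeasurableSpace E]

@[fun_prop]
lemma measurable_shift (k : ℕ) : Measurable (shift k : (ℕ → E) → ℕ → E) :=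
  measurable_pi_lambda _ fun n => measurable_pi_apply (n + k)

@[fun_prop]
lemma measurable_seqCons : Measurable fun z : E × (ℕ → E) => seqCons z.1 z.2 := by
  refine measurable_pi_lambda _ fun n => ?_
  cases n with
  | zero => exact measurable_fst
  | succ n => exact (measurable_pi_apply n).comp measurable_snd

variable (ρ : Measure E) [IsProbabilityMeasure ρ]

lemma map_shift_infinitePi (k : ℕ) :
    (Measure.infinitePi fun _ : ℕ => ρ).map (shift k) = Measure.infinitePi fun _ : ℕ => ρ :=
  Measure.map_infinitePi_infinitePi_of_inj (P := fun _ : ℕ => ρ) (f := fun n : ℕ => n + k)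
    (add_left_injective k)

/-- Under prepending, a finite cylinder pulls back to a product of a condition on the new term and a
cylinder in the rest. This is the tool for conditioning on the first jump. -/
lemma map_seqCons_infinitePi :
    (ρ.prod (Measure.infinitePi fun _ : ℕ => ρ)).map (fun z => seqCons z.1 z.2) =
      Measure.infinitePi fun _ : ℕ => ρ := by
  refine Measure.eq_infinitePi _ fun s t ht => ?_
  rw [Measure.map_apply measurable_seqCons
    (MeasurableSet.pi s.countable_toSet fun i _ => ht i)]
  set m := s.sup id with hm
  have hs : s ⊆ Finset.range (m + 1) := fun i hi =>
    Finset.mem_range.2 (Nat.lt_succ_of_le (Finset.le_sup (f := id) hi))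
  let t' : ℕ → Set E := fun i => if i ∈ s then t i else Set.univ
  have ht' : ∀ i, MeasurableSet (t' i) := fun i => by
    by_cases h : i ∈ s <;> simp [t', h, ht]
  have hpre : (fun z : E × (ℕ → E) => seqCons z.1 z.2) ⁻¹' ((s : Set ℕ).pi t) =
      t' 0 ×ˢ ((Finset.range m : Set ℕ).pi fun i => t' (i + 1)) := by
    ext z
    simp only [Set.mem_preimage, Set.mem_pi, Set.mem_prod, Finset.mem_coe, Finset.mem_range]
    constructor
    · intro h
      refine ⟨?_, fun i _ => ?_⟩
      · by_cases h0 : 0 ∈ s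
        · simpa [t', h0] using h 0 h0
        · simp [t', h0]
      · by_cases h0 : i + 1 ∈ s
        · simpa [t', h0] using h (i + 1) h0
        · simp [t', h0]
    · rintro ⟨h0, h1⟩ i hi
      cases i with
      | zero => simpa [t', hi] using h0
      | succ i =>
        have := h1 i (by have := Finset.mem_range.1 (hs hi); omega)
        simpa [t', hi] using this
  rw [hpre, Measure.prod_prod, Measure.infinitePi_pi _ fun i _ => ht' (i + 1),
    mul_comm, ← Finset.prod_range_succ' (fun i => ρ (t' i)) m,
    ← Finset.prod_subset hs]
  · exact Finset.prod_congr rfl fun i hi => by simp [t', hi]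
  · intro i _ hi
    simp [t', hi]

lemma lintegral_infinitePi_eq_seqCons {f : (ℕ → E) → ENNReal} (hf : Measurable f) :
    ∫⁻ ω, f ω ∂(Measure.infinitePi fun _ : ℕ => ρ) =
      ∫⁻ a, ∫⁻ ω, f (seqCons a ω) ∂(Measure.infinitePi fun _ : ℕ => ρ) ∂ρ := by
  conv_lhs => rw [← map_seqCons_infinitePi ρ]
  rw [lintegral_map hf measurable_seqCons,
    lintegral_prod (fun z => f (seqCons z.1 z.2)) (hf.comp measurable_seqCons).aemeasurable]

/-- `f` depends on the first `l` terms of the sequence only. -/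
def DependsOnFirst {F : Type*} (l : ℕ) (f : (ℕ → E) → F) : Prop :=
  ∀ ω ω' : ℕ → E, (∀ i < l, ω i = ω' i) → f ω = f ω'

variable {F G : Type*} [MeasurableSpace F] [MeasurableSpace G]

lemma indepFun_comp_shift {j k l m : ℕ} (h : j + l ≤ k) {f : (ℕ → E) → F} {g : (ℕ → E) → G}
    (hf : Measurable f) (hg : Measurable g)
    (hfl : DependsOnFirst l f) (hgm : DependsOnFirst m g) :
    IndepFun (fun ω => f (shift j ω)) (fun ω => g (shift k ω))
      (Measure.infinitePi fun _ : ℕ => ρ) := by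
  obtain ⟨e⟩ : Nonempty E := nonempty_of_isProbabilityMeasure ρ
  have hind : iIndepFun (fun (i : ℕ) (ω : ℕ → E) => ω i) (Measure.infinitePi fun _ : ℕ => ρ) :=
    iIndepFun_infinitePi (P := fun _ : ℕ => ρ) (X := fun _ => id) fun _ => measurable_id
  have key := hind.indepFun_finset (Finset.Ico j (j + l)) (Finset.Ico k (k + m))
    (by
      rw [Finset.disjoint_left]
      intro a ha hb
      rw [Finset.mem_Ico] at ha hb
      omega) fun i => measurable_pi_apply i
  -- A full sequence is rebuilt from a finite block, with the arbitrary value `e` outside it; `f`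
  -- and `g` do not see the filler.
  let ext (s : Finset ℕ) (i : ℕ) (y : s → E) : ℕ → E :=
    fun n => if hn : n + i ∈ s then y ⟨n + i, hn⟩ else e
  have hext : ∀ s i, Measurable (ext s i) := fun s i => by
    refine measurable_pi_lambda _ fun n => ?_
    by_cases hn : n + i ∈ s
    · simpa [ext, hn] using measurable_pi_apply _
    · simp [ext, hn]
  have := key.comp (φ := fun y => f (ext _ j y)) (ψ := fun y => g (ext _ k y))
    (hf.comp (hext _ _)) (hg.comp (hext _ _))
  convert this using 1
  · funext ω
    refine hfl _ _ fun i hi => ?_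
    simp [ext, hi, add_comm]
  · funext ω
    refine hgm _ _ fun i hi => ?_
    simp [ext, hi, add_comm]

end Shift

/-! ### A law of large numbers along shifts -/

/-- If the averages along every residue class modulo `l` converge to `c`, so do all averages. -/
lemma tendsto_average_of_residues {a : ℕ → ℝ} {c : ℝ} {l : ℕ} (hl : 0 < l)
    (h : ∀ r < l, Tendsto (fun n : ℕ => (∑ i ∈ Finset.range n, a (i * l + r)) / n) atTop (𝓝 c)) :
    Tendsto (fun n : ℕ => (∑ k ∈ Finset.range n, a k) / n) atTop (𝓝 c) := by
  have hl' : (0 : ℝ) < l := by exact_mod_cast hl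
  -- The number of `k < n` congruent to `r` modulo `l`, that is, `(n - r) / l` rounded up; nothing
  -- is truncated, since `r ≤ l - 1`.
  let m (r n : ℕ) : ℕ := (n + l - 1 - r) / l
  have hsum : ∀ n, ∑ k ∈ Finset.range n, a k =
      ∑ r ∈ Finset.range l, ∑ i ∈ Finset.range (m r n), a (i * l + r) := by
    intro n
    rw [Finset.sum_sigma']
    refine Finset.sum_bij' (fun k _ => (⟨k % l, k / l⟩ : (_ : ℕ) × ℕ))
      (fun z _ => z.2 * l + z.1) ?_ ?_ ?_ ?_ ?_
    · intro k hk
      simp only [Finset.mem_range, Finset.mem_sigma] at hk ⊢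
      refine ⟨Nat.mod_lt _ hl, ?_⟩
      have h1 := Nat.mod_lt k hl
      have h2 := Nat.mod_add_div k l
      rw [Nat.lt_iff_add_one_le, Nat.le_div_iff_mul_le hl, add_mul, one_mul, mul_comm]
      omega
    · rintro ⟨r, i⟩ hz
      simp only [Finset.mem_range, Finset.mem_sigma] at hz ⊢
      have h1 := hz.2
      rw [Nat.lt_iff_add_one_le, Nat.le_div_iff_mul_le hl, add_mul, one_mul] at h1
      omega
    · intro k _
      simpa [mul_comm] using Nat.div_add_mod k l
    · rintro ⟨r, i⟩ hz
      simp only [Finset.mem_range, Finset.mem_sigma] at hz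
      have h1 : (i * l + r) % l = r := by
        rw [mul_comm, Nat.mul_add_mod, Nat.mod_eq_of_lt hz.1]
      have h2 : (i * l + r) / l = i := by
        rw [mul_comm, Nat.mul_add_div hl, Nat.div_eq_of_lt hz.1, add_zero]
      simp [h1, h2]
    · intro k _
      congr 1
      simpa [mul_comm] using (Nat.div_add_mod k l).symm
  have hm : ∀ r < l, Tendsto (fun n => m r n) atTop atTop := by
    intro r hr
    refine tendsto_atTop.2 fun b => ?_
    filter_upwards [eventually_ge_atTop (b * l)] with n hn
    rw [Nat.le_div_iff_mul_le hl]
    omega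
  have hmn : ∀ r < l, Tendsto (fun n : ℕ => (m r n : ℝ) / n) atTop (𝓝 (1 / l)) := by
    intro r hr
    have hlow : Tendsto (fun n : ℕ => 1 / (l : ℝ) - 1 / n) atTop (𝓝 (1 / l)) := by
      simpa using (tendsto_const_nhds (x := 1 / (l : ℝ))).sub
        (tendsto_one_div_atTop_nhds_zero_nat (𝕜 := ℝ))
    have hupp : Tendsto (fun n : ℕ => 1 / (l : ℝ) + 1 / n) atTop (𝓝 (1 / l)) := by
      simpa using (tendsto_const_nhds (x := 1 / (l : ℝ))).add
        (tendsto_one_div_atTop_nhds_zero_nat (𝕜 := ℝ))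
    refine tendsto_of_tendsto_of_tendsto_of_le_of_le' hlow hupp ?_ ?_
    · filter_upwards [eventually_gt_atTop 0] with n hn
      have hn' : (0 : ℝ) < n := by exact_mod_cast hn
      have h1 : n < (m r n + 1) * l + 1 := by
        have := Nat.lt_div_mul_add (a := n + l - 1 - r) hl
        simp only [m, add_mul]
        omega
      have h2 : (n : ℝ) ≤ (m r n + 1) * l := by exact_mod_cast Nat.lt_succ_iff.1 h1
      rw [div_sub_div _ _ hl'.ne' hn'.ne', div_le_div_iff₀ (by positivity) hn']
      nlinarith
    · filter_upwards [eventually_gt_atTop 0] with n hn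
      have hn' : (0 : ℝ) < n := by exact_mod_cast hn
      have h1 : m r n * l ≤ n + l := by
        have := Nat.div_mul_le_self (n + l - 1 - r) l
        simp only [m]
        omega
      have h2 : (m r n : ℝ) * l ≤ n + l := by exact_mod_cast h1
      rw [div_add_div _ _ hl'.ne' hn'.ne', div_le_div_iff₀ hn' (by positivity)]
      nlinarith
  have hlim : Tendsto (fun n : ℕ => ∑ r ∈ Finset.range l,
      (∑ i ∈ Finset.range (m r n), a (i * l + r)) / (m r n : ℕ) * ((m r n : ℝ) / n)) atTop
      (𝓝 (∑ r ∈ Finset.range l, c * (1 / l))) :=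
    tendsto_finsetSum _ fun r hr =>
      ((h r (Finset.mem_range.1 hr)).comp (hm r (Finset.mem_range.1 hr))).mul
        (hmn r (Finset.mem_range.1 hr))
  have hc : ∑ r ∈ Finset.range l, c * (1 / (l : ℝ)) = c := by
    simp only [Finset.sum_const, Finset.card_range, nsmul_eq_mul]
    field_simp
  rw [hc] at hlim
  refine hlim.congr' ?_
  filter_upwards [eventually_gt_atTop 0] with n _
  rw [hsum, Finset.sum_div]
  refine Finset.sum_congr rfl fun r _ => ?_
  by_cases h0 : m r n = 0
  · simp [h0]
  · have : (m r n : ℝ) ≠ 0 := by exact_mod_cast h0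
    field_simp

/-- The strong law of large numbers for a function of finitely many terms of an i.i.d. sequence,
evaluated along the shifts of the sequence. -/
lemma tendsto_average_shift {E : Type*} [MeasurableSpace E] (ρ : Measure E)
    [IsProbabilityMeasure ρ] {f : (ℕ → E) → ℝ} {l : ℕ} (hf : Measurable f)
    (hfl : DependsOnFirst l f) (hint : Integrable f (Measure.infinitePi fun _ : ℕ => ρ)) :
    ∀ᵐ ω ∂(Measure.infinitePi fun _ : ℕ => ρ),
      Tendsto (fun n : ℕ => (∑ k ∈ Finset.range n, f (shift k ω)) / n) atTop
        (𝓝 (∫ ω, f ω ∂(Measure.infinitePi fun _ : ℕ => ρ))) := by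
  set P := Measure.infinitePi fun _ : ℕ => ρ with hP
  -- The modulus `l + 1` is positive even for `l = 0`, and shifts along one residue class then read
  -- disjoint blocks.
  have hfl' : DependsOnFirst (l + 1) f := fun ω ω' h => hfl ω ω' fun i hi => h i (by omega)
  have hid : ∀ k, IdentDistrib (fun ω => f (shift k ω)) f P P := fun k =>
    ⟨(hf.comp (measurable_shift k)).aemeasurable, hf.aemeasurable, by
      change P.map (f ∘ shift k) = P.map f
      rw [← Measure.map_map hf (measurable_shift k), map_shift_infinitePi]⟩
  have key : ∀ r, ∀ᵐ ω ∂P, Tendsto (fun n : ℕ =>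
      (∑ i ∈ Finset.range n, f (shift (i * (l + 1) + r) ω)) / n) atTop (𝓝 (∫ ω, f ω ∂P)) := by
    intro r
    have := strong_law_ae_real (μ := P) (fun i ω => f (shift (i * (l + 1) + r) ω))
      ((hid _).integrable_iff.2 hint) ?_ fun i => (hid _).trans (hid _).symm
    · simpa only [(hid _).integral_eq] using this
    · intro i j hij
      rcases lt_or_gt_of_ne hij with h | h
      · exact indepFun_comp_shift ρ (by nlinarith) hf hf hfl' hfl'
      · exact (indepFun_comp_shift ρ (by nlinarith) hf hf hfl' hfl').symm
  filter_upwards [ae_all_iff.2 key] with ω hω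
  exact tendsto_average_of_residues (a := fun k => f (shift k ω)) (Nat.succ_pos l) fun r _ => hω r

/-! ### The exponential distribution -/

section Exponential

variable {r : ℝ}

lemma lintegral_expMeasure (r : ℝ) (f : ℝ → ENNReal) (hf : Measurable f) :
    ∫⁻ x, f x ∂(expMeasure r) = ∫⁻ x, exponentialPDF r x * f x := by
  have h : Measurable (exponentialPDF r) :=
    (measurable_exponentialPDFReal r).ennreal_ofReal
  exact lintegral_withDensity_eq_lintegral_mul volume h hf

lemma ae_nonneg_expMeasure (r : ℝ) : ∀ᵐ x ∂(expMeasure r), 0 ≤ x := by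
  rw [ae_iff, ← lintegral_indicator_one]
  · rw [lintegral_expMeasure _ _ (measurable_one.indicator (by measurability))]
    rw [← lintegral_zero (μ := (volume : Measure ℝ))]
    refine lintegral_congr fun x => ?_
    by_cases hx : 0 ≤ x
    · simp [hx]
    · rw [exponentialPDF_of_neg (not_le.1 hx), zero_mul]
  · measurability

lemma expMeasure_singleton (r x : ℝ) : expMeasure r {x} = 0 :=
  withDensity_absolutelyContinuous volume _ (measure_singleton x)

lemma integrable_id_expMeasure (hr : 0 < r) : Integrable (fun x : ℝ => x) (expMeasure r) := by
  refine ⟨measurable_id.aestronglyMeasurable, ?_⟩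
  rw [HasFiniteIntegral, lintegral_expMeasure _ _ (by fun_prop)]
  have h : IntegrableOn (fun x : ℝ => r * (x ^ (1 : ℝ) * Real.exp (-r * x))) (Set.Ioi 0) :=
    (integrableOn_rpow_mul_exp_neg_mul_rpow (p := 1) (s := 1) (by norm_num) one_pos hr
      |>.congr_fun (fun x _ => by simp) measurableSet_Ioi).const_mul r
  have h2 := h.2
  rw [HasFiniteIntegral] at h2
  refine lt_of_le_of_lt ?_ h2
  rw [← lintegral_indicator measurableSet_Ioi]
  refine lintegral_mono fun x => ?_
  rcases lt_trichotomy x 0 with hx | hx | hx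
  · rw [exponentialPDF_of_neg hx, zero_mul]
    exact zero_le
  · simp [hx]
  · rw [Set.indicator_of_mem (Set.mem_Ioi.2 hx), exponentialPDF_of_nonneg hx.le, enorm_mul,
      enorm_mul, Real.rpow_one, Real.enorm_of_nonneg hr.le, Real.enorm_of_nonneg hx.le,
      Real.enorm_of_nonneg (Real.exp_pos _).le, ENNReal.ofReal_mul hr.le, neg_mul]
    exact le_of_eq (by ring)

/-- The exponential distribution has no memory. -/
lemma lintegral_expMeasure_Ioi {s : ℝ} (hs : 0 ≤ s) {f : ℝ → ENNReal}
    (hf : Measurable f) :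
    ∫⁻ x in Set.Ioi s, f (x - s) ∂(expMeasure r) =
      ENNReal.ofReal (Real.exp (-(r * s))) * ∫⁻ x, f x ∂(expMeasure r) := by
  rw [← lintegral_indicator measurableSet_Ioi,
    lintegral_expMeasure _ _ ((by fun_prop : Measurable fun x => f (x - s)).indicator
      measurableSet_Ioi), lintegral_expMeasure _ _ hf,
    ← lintegral_const_mul (μ := volume) _
      (show Measurable fun x => exponentialPDF r x * f x from
        (measurable_exponentialPDFReal r).ennreal_ofReal.mul hf),
    ← lintegral_add_right_eq_self _ s]
  refine lintegral_congr_ae ?_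
  -- The integrands may differ at `0`, where the density is `r` but the translated open half-line is
  -- missed.
  filter_upwards [compl_mem_ae_iff.2 (measure_singleton (μ := volume) (0 : ℝ))] with x hx
  rcases lt_or_gt_of_ne (show x ≠ 0 from hx) with h | h
  · rw [exponentialPDF_of_neg h, Set.indicator_of_notMem (by simp [h.le])]
    simp
  · rw [Set.indicator_of_mem (by simp [h]), exponentialPDF_of_nonneg h.le,
      exponentialPDF_of_nonneg (by positivity), add_sub_cancel_right, ← mul_assoc,
      ← ENNReal.ofReal_mul (Real.exp_pos _).le]
    congr 2
    rw [mul_left_comm, ← Real.exp_add]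
    ring_nf

lemma expMeasure_Ioi (hr : 0 < r) {s : ℝ} (hs : 0 ≤ s) :
    expMeasure r (Set.Ioi s) = ENNReal.ofReal (Real.exp (-(r * s))) := by
  have := isProbabilityMeasure_expMeasure hr
  simpa using lintegral_expMeasure_Ioi (r := r) hs (f := fun _ => 1) measurable_const

end Exponential

/-! ### Genealogy: ancestors, coalescence and displacements -/

variable {N : Fin 2 → ℕ}

/-- A jump as a map of the set of particles: the particle sitting, before the jump, at the place
taken by the given particle after the jump. -/
def jumpMap (e : Jump N) : Particle N → Particle N := Function.update id e.1 e.2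

lemma applyJump_apply (e : Jump N) (x : Config N) (p : Particle N) :
    applyJump e x p = x (jumpMap e p) := by
  by_cases h : p = e.1
  · subst h
    simp [applyJump, jumpMap]
  · simp [applyJump, jumpMap, h]

/-- The particle at time `0` from whose place the particle `p` descends after `n` jumps. -/
def ancestor (ω : ℕ → ℝ × Jump N) : ℕ → Particle N → Particle N
  | 0 => id
  | n + 1 => ancestor ω n ∘ jumpMap (ω n).2

lemma ancestor_succ (ω : ℕ → ℝ × Jump N) (n : ℕ) (p : Particle N) :
    ancestor ω (n + 1) p = ancestor ω n (jumpMap (ω n).2 p) := rfl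

/-- The latest jump is undone first, so the later block, read from the shifted sequence, is the
inner map. Hence one constant block, early or late, makes the whole composition constant. -/
lemma ancestor_add (ω : ℕ → ℝ × Jump N) (n m : ℕ) (p : Particle N) :
    ancestor ω (n + m) p = ancestor ω n (ancestor (shift n ω) m p) := by
  induction m generalizing p with
  | zero => rfl
  | succ m ih =>
    rw [← add_assoc, ancestor_succ, ih, ancestor_succ, shift_apply, add_comm m n]

lemma ancestor_congr {ω ω' : ℕ → ℝ × Jump N} {n : ℕ} (h : ∀ i < n, (ω i).2 = (ω' i).2) :
    ancestor ω n = ancestor ω' n := by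
  induction n with
  | zero => rfl
  | succ n ih =>
    funext p
    rw [ancestor_succ, ancestor_succ, ih fun i hi => h i (by omega), h n (by omega)]

/-- After `n` jumps all the particles descend from the same one. -/
def Coalesced (ω : ℕ → ℝ × Jump N) (n : ℕ) : Prop :=
  ∀ p q, ancestor ω n p = ancestor ω n q

lemma Coalesced.mono {ω : ℕ → ℝ × Jump N} {n m : ℕ} (h : Coalesced ω n) (hnm : n ≤ m) :
    Coalesced ω m := by
  obtain ⟨k, rfl⟩ := Nat.exists_eq_add_of_le hnm
  intro p q
  rw [ancestor_add, ancestor_add]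
  exact h _ _

lemma Coalesced.add {ω : ℕ → ℝ × Jump N} {n m : ℕ} (h : Coalesced (shift n ω) m) :
    Coalesced ω (n + m) := by
  intro p q
  rw [ancestor_add, ancestor_add, h p q]

/-- The displacement accumulated along the ancestral line of the particle `p` during the first `n`
waiting times. -/
noncomputable def displacement (v : Fin 2 → ℝ) (ω : ℕ → ℝ × Jump N) (n : ℕ) (p : Particle N) : ℝ :=
  ∑ k ∈ Finset.range n, (ω k).1 * v (ancestor (shift k ω) (n - k) p).1

/-- The start enters only through the value of `x` at the ancestor. In the displacement, the wait
number `k` precedes the jump number `k`, so the ancestor travelling then is found by undoing the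
jumps `k, …, n - 1`. -/
lemma configAfter_eq (v : Fin 2 → ℝ) (x : Config N) (ω : ℕ → ℝ × Jump N) (n : ℕ)
    (p : Particle N) :
    configAfter v x ω n p = x (ancestor ω n p) + displacement v ω n p := by
  induction n generalizing p with
  | zero => simp [configAfter, ancestor, displacement]
  | succ n ih =>
    rw [configAfter, applyJump_apply, freeMotion, ih, displacement, displacement,
      Finset.sum_range_succ, ancestor_succ, add_assoc]
    congr 2
    · refine Finset.sum_congr rfl fun k hk => ?_
      have hk' := Finset.mem_range.1 hk
      rw [Nat.sub_add_comm hk'.le, ancestor_succ, shift_apply, Nat.sub_add_cancel hk'.le]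
    · rw [Nat.add_sub_cancel_left, ancestor_succ, shift_apply, zero_add]
      simp [ancestor, mul_comm]

/-- A sequence of jumps with positive rates which makes all the particles descend from a
particle of the faster type. -/
lemma exists_coalescing_jumps (hN : ∀ i, 0 < N i) {α : Fin 2 → Fin 2 → ℝ} (hα₀₁ : 0 < α 0 1)
    (hα₁₀ : 0 < α 1 0) :
    ∃ (a : Particle N) (m : ℕ) (e : ℕ → Jump N), a.1 = 1 ∧ (∀ k < m, 0 < jumpRate α (e k)) ∧
      ∀ ω : ℕ → ℝ × Jump N, (∀ k < m, (ω k).2 = e k) → ∀ p, ancestor ω m p = a := by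
  let a : Particle N := ⟨1, ⟨0, hN 1⟩⟩
  let b : Particle N := ⟨0, ⟨0, hN 0⟩⟩
  -- `R S` says that some admissible word of jumps sends all of `S` back to `a`. A new jump is
  -- appended in time, hence undone first. In order of time, all slow particles jump to the fast
  -- `a`, then all fast ones jump to the slow `b`, which holds the place of `a`; no jump within a
  -- type is used.
  let R (S : Set (Particle N)) : Prop := ∃ (m : ℕ) (e : ℕ → Jump N),
    (∀ k < m, 0 < jumpRate α (e k)) ∧
      ∀ ω : ℕ → ℝ × Jump N, (∀ k < m, (ω k).2 = e k) → ∀ p ∈ S, ancestor ω m p = a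
  have hNpos : ∀ i, (0 : ℝ) < N i := fun i => by exact_mod_cast hN i
  have step : ∀ S p q, R S → q ∈ S → 0 < jumpRate α (p, q) → R (insert p S) := by
    rintro S p q ⟨m, e, he, h⟩ hq hpq
    refine ⟨m + 1, Function.update e m (p, q), fun k hk => ?_, fun ω hω r hr => ?_⟩
    · by_cases hkm : k = m
      · subst hkm
        simpa using hpq
      · simpa [hkm] using he k (by omega)
    · have h1 := h ω fun k hk => by simpa [hk.ne] using hω k (by omega)
      have h2 : (ω m).2 = (p, q) := by simpa using hω m (by omega)
      rw [ancestor_succ, h2]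
      by_cases hrp : r = p
      · subst hrp
        simpa [jumpMap] using h1 q hq
      · simpa [jumpMap, hrp] using h1 r (hr.resolve_left hrp)
  have many : ∀ (T : Finset (Particle N)) (S : Set (Particle N)), ∀ q ∈ S, R S →
      (∀ p ∈ T, 0 < jumpRate α (p, q)) → R (↑T ∪ S) := by
    intro T S q hq hS
    induction T using Finset.induction_on with
    | empty => intro _; simpa using hS
    | insert p T hp ih =>
      intro h
      rw [Finset.coe_insert, Set.insert_union]
      exact step _ p q (ih fun r hr => h r (Finset.mem_insert_of_mem hr)) (Or.inr hq)
        (h p (Finset.mem_insert_self _ _))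
  have h0 : R {a} := ⟨0, fun _ => (a, a), by simp, fun ω _ p hp => hp⟩
  have h1 := many (Finset.univ.filter fun p => p.1 = 0) {a} a rfl h0 fun p hp => by
    have : p.1 = 0 := by simpa using hp
    simpa [jumpRate, this, a] using div_pos hα₀₁ (hNpos 1)
  have h2 := many (Finset.univ.filter fun p => p.1 = 1) _ b (Or.inl (by simp [b])) h1 fun p hp => by
    have : p.1 = 1 := by simpa using hp
    simpa [jumpRate, this, b] using div_pos hα₁₀ (hNpos 0)
  obtain ⟨m, e, he, h⟩ := h2
  refine ⟨a, m, e, rfl, he, fun ω hω p => h ω hω p ?_⟩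
  have : p.1 = 0 ∨ p.1 = 1 := by
    generalize p.1 = i
    fin_cases i <;> simp
  rcases this with h | h
  · exact Or.inr (Or.inl (by simpa using h))
  · exact Or.inl (by simpa using h)

/-! ### Probability instances and measurability -/

/-- The rates are nonnegative and not all zero. -/
class PositiveRates (N : Fin 2 → ℕ) (α : Fin 2 → Fin 2 → ℝ) : Prop where
  nonneg : ∀ i j, 0 ≤ α i j
  totalRate_pos : 0 < totalRate N α

lemma jumpRate_nonneg {α : Fin 2 → Fin 2 → ℝ} (hα : ∀ i j, 0 ≤ α i j) (e : Jump N) :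
    0 ≤ jumpRate α e :=
  div_nonneg (hα _ _) (Nat.cast_nonneg _)

lemma PositiveRates.of_jumpRate_pos {α : Fin 2 → Fin 2 → ℝ} (hα : ∀ i j, 0 ≤ α i j)
    (e : Jump N) (he : 0 < jumpRate α e) : PositiveRates N α :=
  ⟨hα, he.trans_le
    (Finset.single_le_sum (fun e _ => jumpRate_nonneg hα e) (Finset.mem_univ e))⟩

section Instances

instance : DiscreteMeasurableSpace (Particle N) :=
  ⟨fun s => by
    refine MeasurableSpace.measurableSet_iInf.2 fun i => ?_
    exact MeasurableSet.of_discrete (s := Sigma.mk i ⁻¹' s)⟩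

variable {α : Fin 2 → Fin 2 → ℝ} [hr : PositiveRates N α]

instance : IsProbabilityMeasure (expMeasure (totalRate N α)) :=
  isProbabilityMeasure_expMeasure hr.totalRate_pos

instance : IsProbabilityMeasure (jumpLaw N α) := by
  refine ⟨?_⟩
  simp only [jumpLaw, Measure.coe_finsetSum, Finset.sum_apply, Measure.smul_apply, measure_univ,
    smul_eq_mul, mul_one]
  rw [← ENNReal.ofReal_sum_of_nonneg fun e _ =>
    div_nonneg (jumpRate_nonneg hr.nonneg e) hr.totalRate_pos.le, ← Finset.sum_div,
    ← totalRate, div_self hr.totalRate_pos.ne', ENNReal.ofReal_one]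

instance : IsProbabilityMeasure (drivingLaw N α) := by
  unfold drivingLaw
  infer_instance

end Instances

lemma jumpLaw_singleton_pos {α : Fin 2 → Fin 2 → ℝ} [hr : PositiveRates N α] {e : Jump N}
    (he : 0 < jumpRate α e) : 0 < jumpLaw N α {e} := by
  have h1 : 0 < ENNReal.ofReal (jumpRate α e / totalRate N α) :=
    ENNReal.ofReal_pos.2 (div_pos he hr.totalRate_pos)
  refine h1.trans_le ?_
  simp only [jumpLaw, Measure.coe_finsetSum, Finset.sum_apply, Measure.smul_apply, smul_eq_mul]
  refine le_trans ?_ (Finset.single_le_sum (fun _ _ => zero_le) (Finset.mem_univ e))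
  simp

@[fun_prop]
lemma measurable_ancestor (n : ℕ) (p : Particle N) :
    Measurable fun ω : ℕ → ℝ × Jump N => ancestor ω n p := by
  induction n generalizing p with
  | zero => exact measurable_const
  | succ n ih =>
    have h1 : Measurable fun z : Particle N × (ℕ → ℝ × Jump N) => ancestor z.2 n z.1 :=
      measurable_from_prod_countable_right fun q => ih q
    have h2 : Measurable fun ω : ℕ → ℝ × Jump N => jumpMap (ω n).2 p :=
      (measurable_of_countable fun e : Jump N => jumpMap e p).comp
        (measurable_snd.comp (measurable_pi_apply n))
    exact h1.comp (h2.prodMk measurable_id)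

lemma measurableSet_coalesced (n : ℕ) :
    MeasurableSet {ω : ℕ → ℝ × Jump N | Coalesced ω n} := by
  simp only [Coalesced, Set.ofPred_forall]
  exact MeasurableSet.iInter fun p => MeasurableSet.iInter fun q =>
    measurableSet_eq_fun (measurable_ancestor n p) (measurable_ancestor n q)

lemma coalesced_congr {ω ω' : ℕ → ℝ × Jump N} {n : ℕ} (h : ∀ i < n, ω i = ω' i) :
    Coalesced ω n ↔ Coalesced ω' n := by
  rw [Coalesced, Coalesced, ancestor_congr fun i hi => congrArg Prod.snd (h i hi)]

/-! ### Almost sure coalescence and waiting times -/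

section LargeTimes

variable (v : Fin 2 → ℝ) (α : Fin 2 → Fin 2 → ℝ) [hr : PositiveRates N α]

/-- Given finitely many jumps with positive rates, with positive probability they are the first
ones to occur. -/
lemma drivingLaw_jumps_pos {m : ℕ} {e : ℕ → Jump N} (he : ∀ k < m, 0 < jumpRate α (e k)) :
    0 < drivingLaw N α {ω | ∀ k < m, (ω k).2 = e k} := by
  have h : {ω : ℕ → ℝ × Jump N | ∀ k < m, (ω k).2 = e k} =
      (Finset.range m : Set ℕ).pi fun k => Set.univ ×ˢ {e k} := by
    ext ω
    simp [Set.mem_pi]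
  rw [h, drivingLaw, Measure.infinitePi_pi _ fun k _ =>
    MeasurableSet.univ.prod (measurableSet_singleton _)]
  refine pos_iff_ne_zero.2 (Finset.prod_ne_zero_iff.2 fun k hk => ?_)
  rw [Measure.prod_prod, measure_univ, one_mul]
  exact (jumpLaw_singleton_pos (he k (Finset.mem_range.1 hk))).ne'

/-- Failure of the whole block forces failure of both of its parts, and these are independent with
the right laws. -/
lemma drivingLaw_not_coalesced_add_le (n m : ℕ) :
    drivingLaw N α {ω | ¬ Coalesced ω (n + m)} ≤
      drivingLaw N α {ω | ¬ Coalesced ω n} * drivingLaw N α {ω | ¬ Coalesced ω m} := by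
  have hm : ∀ k, Measurable fun ω : ℕ → ℝ × Jump N => Coalesced ω k := fun k =>
    measurableSet_setOfPred.1 (measurableSet_coalesced k)
  have hd : ∀ k, DependsOnFirst k fun ω : ℕ → ℝ × Jump N => Coalesced ω k :=
    fun k ω ω' h => propext (coalesced_congr h)
  have hind := indepFun_comp_shift ((expMeasure (totalRate N α)).prod (jumpLaw N α))
    (j := 0) (k := n) (by omega) (hm n) (hm m) (hd n) (hd m)
  have hset : MeasurableSet {p : Prop | ¬ p} := MeasurableSet.of_discrete
  have h1 := hind.measure_inter_preimage_eq_mul _ _ hset hset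
  have h2 : drivingLaw N α {ω | ¬ Coalesced (shift n ω) m} =
      drivingLaw N α {ω | ¬ Coalesced ω m} := by
    conv_rhs => rw [drivingLaw, ← map_shift_infinitePi _ n]
    exact (Measure.map_apply (measurable_shift n) (measurableSet_coalesced m).compl).symm
  rw [← h2]
  refine le_trans (measure_mono ?_) h1.le
  intro ω hω
  exact ⟨fun h => hω (Coalesced.mono h (Nat.le_add_right _ _)), fun h => hω (Coalesced.add h)⟩

lemma ae_exists_coalesced (hN : ∀ i, 0 < N i) (hα₀₁ : 0 < α 0 1) (hα₁₀ : 0 < α 1 0) :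
    ∀ᵐ ω ∂(drivingLaw N α), ∃ n, Coalesced ω n := by
  obtain ⟨a, m, e, -, he, h⟩ := exists_coalescing_jumps hN hα₀₁ hα₁₀
  set q := drivingLaw N α {ω | ¬ Coalesced ω m} with hq
  have hq1 : q < 1 := by
    have h1 : 0 < drivingLaw N α {ω | Coalesced ω m} :=
      (drivingLaw_jumps_pos α he).trans_le
        (measure_mono fun ω hω p p' => by rw [h ω hω p, h ω hω p'])
    have h2 := prob_add_prob_compl (μ := drivingLaw N α) (measurableSet_coalesced m)
    rw [← h2]
    rw [add_comm]
    exact ENNReal.lt_add_right (measure_ne_top _ _) h1.ne'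
  -- Submultiplicativity gives geometric decay, with ratio `q < 1` because the coalescing word of
  -- length `m` has positive probability.
  have hpow : ∀ k : ℕ, drivingLaw N α {ω | ¬ Coalesced ω (k * m)} ≤ q ^ k := by
    intro k
    induction k with
    | zero => simpa using prob_le_one
    | succ k ih =>
      rw [add_mul, one_mul, pow_succ]
      exact (drivingLaw_not_coalesced_add_le α _ _).trans (mul_le_mul_left ih _)
  rw [ae_iff]
  refine le_antisymm (ge_of_tendsto' (ENNReal.tendsto_pow_atTop_nhds_zero_of_lt_one hq1)
    fun k => (measure_mono ?_).trans (hpow k)) zero_le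
  exact fun ω (hω : ¬ ∃ n, Coalesced ω n) hc => hω ⟨_, hc⟩

lemma measurePreserving_eval_drivingLaw (k : ℕ) :
    MeasurePreserving (fun ω : ℕ → ℝ × Jump N => (ω k).1) (drivingLaw N α)
      (expMeasure (totalRate N α)) :=
  measurePreserving_fst.comp (measurePreserving_eval_infinitePi
    (fun _ : ℕ => (expMeasure (totalRate N α)).prod (jumpLaw N α)) k)

lemma ae_waitingTime_nonneg : ∀ᵐ ω ∂(drivingLaw N α), ∀ k, 0 ≤ (ω k).1 :=
  ae_all_iff.2 fun k =>
    (measurePreserving_eval_drivingLaw α k).quasiMeasurePreserving.ae (ae_nonneg_expMeasure _)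

lemma ae_waitingTime_pos : ∀ᵐ ω ∂(drivingLaw N α), 0 < (ω 0).1 := by
  refine (measurePreserving_eval_drivingLaw α 0).quasiMeasurePreserving.ae (p := fun x => 0 < x) ?_
  filter_upwards [ae_nonneg_expMeasure (totalRate N α),
    compl_mem_ae_iff.2 (expMeasure_singleton (totalRate N α) 0)] with x hx hx0
  exact lt_of_le_of_ne hx (Ne.symm hx0)

lemma integrable_waitingTime : Integrable (fun ω : ℕ → ℝ × Jump N => (ω 0).1) (drivingLaw N α) :=
  (measurePreserving_eval_drivingLaw α 0).integrable_comp_of_integrable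
    (integrable_id_expMeasure hr.totalRate_pos)

lemma integral_waitingTime_pos : 0 < ∫ ω, (ω 0).1 ∂(drivingLaw N α) := by
  rw [integral_pos_iff_support_of_nonneg_ae ?_ (integrable_waitingTime α)]
  · refine lt_of_lt_of_le (b := drivingLaw N α Set.univ) (by simp) (measure_mono_ae ?_)
    filter_upwards [ae_waitingTime_pos α] with ω hω _
    exact hω.ne'
  · filter_upwards [ae_waitingTime_pos α] with ω hω
    exact hω.le

/-- A bounded weight times the first waiting time. -/
lemma integrable_waitingTime_mul {h : (ℕ → ℝ × Jump N) → ℝ} (hh : Measurable h) {C : ℝ}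
    (hC : ∀ ω, |h ω| ≤ C) :
    Integrable (fun ω : ℕ → ℝ × Jump N => (ω 0).1 * h ω) (drivingLaw N α) :=
  (integrable_waitingTime α).mul_bdd hh.aestronglyMeasurable (ae_of_all _ hC)

end LargeTimes

/-! ### Approximation of displacements by ergodic averages -/

open Classical in
/-- The indicator of the absence of coalescence. -/
noncomputable def defect (l : ℕ) (ω : ℕ → ℝ × Jump N) : ℝ := if Coalesced ω l then 0 else 1

lemma defect_nonneg (l : ℕ) (ω : ℕ → ℝ × Jump N) : 0 ≤ defect l ω := by
  unfold defect; split_ifs <;> simp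

lemma abs_defect_le (l : ℕ) (ω : ℕ → ℝ × Jump N) : |defect l ω| ≤ 1 := by
  unfold defect; split_ifs <;> simp

lemma measurable_defect (l : ℕ) : Measurable (defect l : (ℕ → ℝ × Jump N) → ℝ) :=
  Measurable.ite (measurableSet_coalesced l) measurable_const measurable_const

/-- If the first `l` jumps already coalesce, the ancestor is the same for all starting particles and
all longer blocks; otherwise the trivial bound `V` is used. -/
lemma abs_sub_ancestor_le {v : Fin 2 → ℝ} {V : ℝ} (hV : ∀ i j, |v i - v j| ≤ V)
    (ω : ℕ → ℝ × Jump N) {l m : ℕ} (hlm : l ≤ m) (p q : Particle N) :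
    |v (ancestor ω m p).1 - v (ancestor ω l q).1| ≤ V * defect l ω := by
  obtain ⟨k, rfl⟩ := Nat.exists_eq_add_of_le hlm
  by_cases h : Coalesced ω l
  · rw [ancestor_add, h _ q]
    simp [defect, h]
  · simpa [defect, h] using hV _ _

/-- The varying look-ahead `n - k` is replaced by a fixed `l`. This costs a defect when `n - k`
exceeds `l`, and at most `V` per unit of time during the last `l` waits. -/
lemma abs_displacement_sub_le {v : Fin 2 → ℝ} {V : ℝ} (hV : ∀ i j, |v i - v j| ≤ V)
    {ω : ℕ → ℝ × Jump N} (hω : ∀ k, 0 ≤ (ω k).1) (n l : ℕ) (p q : Particle N) :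
    |displacement v ω n p - ∑ k ∈ Finset.range n, (ω k).1 * v (ancestor (shift k ω) l q).1| ≤
      V * ∑ k ∈ Finset.range n, (ω k).1 * defect l (shift k ω) +
        V * (jumpTime ω n - jumpTime ω (n - l)) := by
  have hV0 : 0 ≤ V := (abs_nonneg _).trans (hV 0 0)
  have hlast : jumpTime ω n - jumpTime ω (n - l) =
      ∑ k ∈ Finset.range n, if n - l ≤ k then (ω k).1 else 0 := by
    rw [jumpTime, jumpTime, ← Finset.sum_Ico_eq_sub _ (Nat.sub_le n l), ← Finset.sum_filter]
    refine Finset.sum_congr ?_ fun _ _ => rfl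
    ext k
    simp [and_comm]
  rw [hlast, displacement, ← Finset.sum_sub_distrib, Finset.mul_sum, Finset.mul_sum,
    ← Finset.sum_add_distrib]
  refine (Finset.abs_sum_le_sum_abs _ _).trans (Finset.sum_le_sum fun k hk => ?_)
  have hk' := Finset.mem_range.1 hk
  rw [← mul_sub, abs_mul, abs_of_nonneg (hω k)]
  by_cases h : n - l ≤ k
  · rw [if_pos h]
    have h1 := mul_le_mul_of_nonneg_left (hV (ancestor (shift k ω) (n - k) p).1
      (ancestor (shift k ω) l q).1) (hω k)
    have h2 := mul_nonneg hV0 (mul_nonneg (hω k) (defect_nonneg l (shift k ω)))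
    linarith
  · rw [if_neg h, mul_zero, add_zero]
    have h1 := mul_le_mul_of_nonneg_left
      (abs_sub_ancestor_le hV (shift k ω) (show l ≤ n - k by omega) p q) (hω k)
    linarith

lemma tendsto_jumpTime_sub {ω : ℕ → ℝ × Jump N} {c : ℝ}
    (h : Tendsto (fun n : ℕ => jumpTime ω n / n) atTop (𝓝 c)) (l : ℕ) :
    Tendsto (fun n : ℕ => (jumpTime ω n - jumpTime ω (n - l)) / n) atTop (𝓝 0) := by
  have h1 : Tendsto (fun n : ℕ => n - l) atTop atTop := tendsto_sub_atTop_nat l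
  have h2 : Tendsto (fun n : ℕ => ((n - l : ℕ) : ℝ) / n) atTop (𝓝 1) := by
    have h3 : Tendsto (fun n : ℕ => 1 - (l : ℝ) * (1 / (n : ℝ))) atTop (𝓝 (1 - l * 0)) :=
      tendsto_const_nhds.sub
        ((tendsto_one_div_atTop_nhds_zero_nat (𝕜 := ℝ)).const_mul (l : ℝ))
    rw [mul_zero, sub_zero] at h3
    refine h3.congr' ?_
    filter_upwards [eventually_ge_atTop (l + 1)] with n hn
    have : (n : ℝ) ≠ 0 := by
      have : n ≠ 0 := by omega
      exact_mod_cast this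
    rw [Nat.cast_sub (by omega)]
    field_simp
  have h3 := h.sub ((h.comp h1).mul h2)
  rw [mul_one, sub_self] at h3
  refine h3.congr' ?_
  filter_upwards [eventually_ge_atTop (l + 1)] with n hn
  have h4 : ((n - l : ℕ) : ℝ) ≠ 0 := by
    have : n - l ≠ 0 := by omega
    exact_mod_cast this
  have h5 : (n : ℝ) ≠ 0 := by
    have : n ≠ 0 := by omega
    exact_mod_cast this
  simp only [Function.comp_apply]
  field_simp

/-- The averaged displacements converge as soon as the displacements are approximated by ergodic
averages with errors which are small on average. -/
lemma tendsto_displacement_div {v : Fin 2 → ℝ} {V : ℝ} (hV : ∀ i j, |v i - v j| ≤ V)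
    {ω : ℕ → ℝ × Jump N} (hω : ∀ k, 0 ≤ (ω k).1) {c₀ c : ℝ} {a ε : ℕ → ℝ} (q : Particle N)
    (hT : Tendsto (fun n : ℕ => jumpTime ω n / n) atTop (𝓝 c₀))
    (ha : ∀ l, Tendsto (fun n : ℕ => (∑ k ∈ Finset.range n,
      (ω k).1 * v (ancestor (shift k ω) l q).1) / n) atTop (𝓝 (a l)))
    (hε : ∀ l, Tendsto (fun n : ℕ => (∑ k ∈ Finset.range n,
      (ω k).1 * defect l (shift k ω)) / n) atTop (𝓝 (ε l)))
    (hac : Tendsto a atTop (𝓝 c)) (hε0 : Tendsto ε atTop (𝓝 0)) (p : Particle N) :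
    Tendsto (fun n : ℕ => displacement v ω n p / n) atTop (𝓝 c) := by
  rw [Metric.tendsto_atTop']
  intro η hη
  have h1 : Tendsto (fun l => |a l - c| + V * ε l) atTop (𝓝 (|c - c| + V * 0)) :=
    ((hac.sub_const c).abs).add (hε0.const_mul V)
  rw [sub_self, abs_zero, mul_zero, add_zero] at h1
  -- The look-ahead `l` is fixed first, to make the limiting error less than `η`; only then does `n`
  -- grow.
  obtain ⟨l, hl⟩ := (h1.eventually_lt_const hη).exists
  have h2 : Tendsto (fun n : ℕ => |(∑ k ∈ Finset.range n,
      (ω k).1 * v (ancestor (shift k ω) l q).1) / n - a l| + |a l - c| +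
      (V * ((∑ k ∈ Finset.range n, (ω k).1 * defect l (shift k ω)) / n) +
        V * ((jumpTime ω n - jumpTime ω (n - l)) / n))) atTop
      (𝓝 (|a l - a l| + |a l - c| + (V * ε l + V * 0))) :=
    ((((ha l).sub_const _).abs).add_const _).add
      (((hε l).const_mul V).add ((tendsto_jumpTime_sub hT l).const_mul V))
  rw [sub_self, abs_zero, zero_add, mul_zero, add_zero] at h2
  obtain ⟨n₀, hn₀⟩ := eventually_atTop.1 (h2.eventually_lt_const hl)
  refine ⟨n₀, fun n hn => ?_⟩
  refine lt_of_le_of_lt ?_ (hn₀ n hn.le)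
  have hn' : (0 : ℝ) < n := by
    have : 0 < n := by omega
    exact_mod_cast this
  have h3 := abs_displacement_sub_le hV hω n l p q
  have h4 : |displacement v ω n p / n - (∑ k ∈ Finset.range n,
      (ω k).1 * v (ancestor (shift k ω) l q).1) / n| ≤
      V * ((∑ k ∈ Finset.range n, (ω k).1 * defect l (shift k ω)) / n) +
        V * ((jumpTime ω n - jumpTime ω (n - l)) / n) := by
    rw [← sub_div, abs_div, abs_of_pos hn', ← mul_div_assoc, ← mul_div_assoc, ← add_div]
    exact div_le_div_of_nonneg_right h3 hn'.le
  rw [Real.dist_eq]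
  have h5 := abs_sub_le (displacement v ω n p / n) ((∑ k ∈ Finset.range n,
      (ω k).1 * v (ancestor (shift k ω) l q).1) / n) c
  have h6 := abs_sub_le ((∑ k ∈ Finset.range n,
      (ω k).1 * v (ancestor (shift k ω) l q).1) / n) (a l) c
  linarith

/-! ### From the number of jumps to continuous time -/

section JumpCount

variable {ω : ℕ → ℝ × Jump N}

lemma jumpTime_mono (hω : ∀ k, 0 ≤ (ω k).1) : Monotone (jumpTime ω) := fun _ _ h =>
  Finset.sum_le_sum_of_subset_of_nonneg (Finset.range_mono h) fun k _ _ => hω k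

lemma lt_jumpTime_jumpCount_succ (h : Tendsto (jumpTime ω) atTop atTop) (t : ℝ) :
    t < jumpTime ω (jumpCount ω t + 1) :=
  Nat.sInf_mem (s := {n : ℕ | t < jumpTime ω (n + 1)})
    (((tendsto_add_atTop_iff_nat 1).2 h).eventually_gt_atTop t).exists

/-- No hypothesis on `ω` is needed: if the infimum is over the empty set, the count is `0` and its
jump time is `0`. -/
lemma jumpTime_jumpCount_le {t : ℝ} (ht : 0 ≤ t) : jumpTime ω (jumpCount ω t) ≤ t := by
  rcases h : jumpCount ω t with _ | n
  · simpa [jumpTime] using ht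
  · have : n < jumpCount ω t := by omega
    exact not_lt.1 (Nat.notMem_of_lt_sInf this)

lemma tendsto_jumpCount (hω : ∀ k, 0 ≤ (ω k).1) (h : Tendsto (jumpTime ω) atTop atTop) :
    Tendsto (jumpCount ω) atTop atTop := by
  refine tendsto_atTop.2 fun n => ?_
  filter_upwards [eventually_ge_atTop (jumpTime ω n)] with t ht
  by_contra hlt
  have h1 := lt_jumpTime_jumpCount_succ h t
  have h2 := jumpTime_mono hω (show jumpCount ω t + 1 ≤ n by omega)
  linarith

lemma tendsto_jumpTime_atTop {c : ℝ} (hc : 0 < c)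
    (h : Tendsto (fun n : ℕ => jumpTime ω n / n) atTop (𝓝 c)) :
    Tendsto (jumpTime ω) atTop atTop := by
  refine (h.pos_mul_atTop hc tendsto_natCast_atTop_atTop).congr' ?_
  filter_upwards [eventually_gt_atTop 0] with n hn
  have : (n : ℝ) ≠ 0 := by exact_mod_cast hn.ne'
  field_simp

/-- The time `t` lies between two consecutive jump times whose ratio tends to `1`, so the limit
along jumps determines the limit in time. The initial coordinates take finitely many values and
vanish in the average. -/
lemma tendsto_path_div (hω : ∀ k, 0 ≤ (ω k).1) {c₀ c : ℝ} (hc₀ : 0 < c₀)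
    (hT : Tendsto (fun n : ℕ => jumpTime ω n / n) atTop (𝓝 c₀)) {v : Fin 2 → ℝ} {p : Particle N}
    (hD : Tendsto (fun n : ℕ => displacement v ω n p / n) atTop (𝓝 c)) (x : Config N) :
    Tendsto (fun t : ℝ≥0 => path v x ω t p / (t : ℝ)) atTop (𝓝 (c / c₀)) := by
  have hTinf := tendsto_jumpTime_atTop hc₀ hT
  have hn : Tendsto (fun t : ℝ≥0 => jumpCount ω t) atTop atTop :=
    (tendsto_jumpCount hω hTinf).comp (NNReal.tendsto_coe_atTop.2 tendsto_id)
  have hpos : ∀ᶠ n in atTop, 0 < jumpTime ω n := hTinf.eventually_gt_atTop 0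
  have hconf : Tendsto (fun n : ℕ => configAfter v x ω n p / jumpTime ω n) atTop
      (𝓝 (c / c₀)) := by
    have hx : Tendsto (fun n : ℕ => x (ancestor ω n p) / n) atTop (𝓝 0) := by
      obtain ⟨C, hC⟩ := (Set.finite_range fun q => |x q|).bddAbove
      refine squeeze_zero_norm (a := fun n : ℕ => C / n) (fun n => ?_)
        (tendsto_const_div_atTop_nhds_zero_nat C)
      rw [Real.norm_eq_abs, abs_div, Nat.abs_cast]
      exact div_le_div_of_nonneg_right (hC ⟨_, rfl⟩) (Nat.cast_nonneg n)
    have h1 := (hx.add hD).div hT hc₀.ne'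
    rw [zero_add] at h1
    refine h1.congr' ?_
    filter_upwards [eventually_gt_atTop 0] with n hn
    have : (n : ℝ) ≠ 0 := by exact_mod_cast hn.ne'
    simp only [Pi.div_apply]
    rw [configAfter_eq, ← add_div, div_div_div_cancel_right₀ this]
  have hratio : Tendsto (fun n : ℕ => jumpTime ω n / jumpTime ω (n + 1)) atTop (𝓝 1) := by
    have h1 := (tendsto_add_atTop_iff_nat 1).2 (tendsto_jumpTime_sub hT 1)
    have h2 := (tendsto_add_atTop_iff_nat 1).2 hT
    have h3 := (h1.div h2 hc₀.ne').const_sub 1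
    rw [zero_div, sub_zero] at h3
    refine h3.congr' ?_
    filter_upwards [(tendsto_add_atTop_iff_nat 1).2 hTinf |>.eventually_gt_atTop 0] with n hn
    have : ((n + 1 : ℕ) : ℝ) ≠ 0 := by positivity
    simp only [Pi.div_apply, Nat.add_sub_cancel]
    rw [div_div_div_cancel_right₀ this, sub_div, div_self hn.ne']
    ring
  have hr : Tendsto (fun t : ℝ≥0 => jumpTime ω (jumpCount ω t) / (t : ℝ)) atTop (𝓝 1) := by
    refine tendsto_of_tendsto_of_tendsto_of_le_of_le' (hratio.comp hn) tendsto_const_nhds ?_ ?_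
    · filter_upwards [eventually_gt_atTop 0] with t ht
      have ht' : (0 : ℝ) < t := by exact_mod_cast ht
      have h0 : 0 ≤ jumpTime ω (jumpCount ω t) := by
        simpa [jumpTime] using jumpTime_mono hω (Nat.zero_le (jumpCount ω t))
      exact div_le_div_of_nonneg_left h0 ht' (lt_jumpTime_jumpCount_succ hTinf t).le
    · filter_upwards [eventually_gt_atTop 0] with t ht
      have ht' : (0 : ℝ) < t := by exact_mod_cast ht
      rw [div_le_one ht']
      exact jumpTime_jumpCount_le ht'.le
  have hfin := ((hconf.comp hn).mul hr).add ((hr.const_sub 1).const_mul (v p.1))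
  rw [sub_self, mul_zero, add_zero, mul_one] at hfin
  refine hfin.congr' ?_
  filter_upwards [eventually_gt_atTop 0, hn.eventually hpos] with t ht hT0
  have ht' : (t : ℝ) ≠ 0 := by exact_mod_cast ht.ne'
  have hT0' := hT0.ne'
  simp only [Function.comp_apply, path, freeMotion]
  field_simp

end JumpCount

/-! ### The asymptotic speed -/

section Speed

variable (v : Fin 2 → ℝ) (α : Fin 2 → Fin 2 → ℝ) [hr : PositiveRates N α]

lemma tendsto_average_waitingTime_mul {h : (ℕ → ℝ × Jump N) → ℝ} {l : ℕ} (hh : Measurable h)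
    (hl : DependsOnFirst l h) {C : ℝ} (hC : ∀ ω, |h ω| ≤ C) :
    ∀ᵐ ω ∂(drivingLaw N α), Tendsto (fun n : ℕ =>
      (∑ k ∈ Finset.range n, (ω k).1 * h (shift k ω)) / n) atTop
        (𝓝 (∫ ω, (ω 0).1 * h ω ∂(drivingLaw N α))) := by
  have := tendsto_average_shift ((expMeasure (totalRate N α)).prod (jumpLaw N α))
    (f := fun ω => (ω 0).1 * h ω) (l := l + 1) (by fun_prop) (fun ω ω' hω => by
      dsimp only
      rw [hω 0 (by omega), hl ω ω' fun i hi => hω i (by omega)])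
    (integrable_waitingTime_mul α hh hC)
  simpa only [shift_apply, zero_add] using! this

lemma tendsto_integral_defect (hN : ∀ i, 0 < N i) (hα₀₁ : 0 < α 0 1) (hα₁₀ : 0 < α 1 0) :
    Tendsto (fun l : ℕ => ∫ ω, (ω 0).1 * defect l ω ∂(drivingLaw N α)) atTop (𝓝 0) := by
  have h := tendsto_integral_of_dominated_convergence (μ := drivingLaw N α)
    (F := fun l ω => (ω 0).1 * defect l ω) (f := fun _ => 0) (fun ω => |(ω 0).1|)
    (fun l => ((integrable_waitingTime_mul α (measurable_defect l)
      (abs_defect_le l)).aestronglyMeasurable))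
    (integrable_waitingTime α).abs
    (fun l => ae_of_all _ fun ω => by
      rw [norm_mul, Real.norm_eq_abs, Real.norm_eq_abs]
      exact mul_le_of_le_one_right (abs_nonneg _) (abs_defect_le l ω)) ?_
  · simpa using h
  · filter_upwards [ae_exists_coalesced α hN hα₀₁ hα₁₀] with ω ⟨n, hn⟩
    refine tendsto_const_nhds.congr' ?_
    filter_upwards [eventually_ge_atTop n] with l hl
    simp [defect, hn.mono hl]

/-- All the particles have the same positive asymptotic speed. -/
lemma exists_speed (hN : ∀ i, 0 < N i) (hv₀ : 0 ≤ v 0) (hv₁ : v 0 < v 1) (hα₀₁ : 0 < α 0 1)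
    (hα₁₀ : 0 < α 1 0) :
    ∃ w : ℝ, 0 < w ∧ ∀ᵐ ω ∂(drivingLaw N α), ∀ (x : Config N) (p : Particle N),
      Tendsto (fun t : ℝ≥0 => path v x ω t p / (t : ℝ)) atTop (𝓝 w) := by
  set P := drivingLaw N α with hP
  set V := v 1 with hVdef
  have hVpos : 0 < V := by linarith
  have hv : ∀ i, 0 ≤ v i ∧ v i ≤ V := fun i => by
    fin_cases i
    · exact ⟨hv₀, hv₁.le⟩
    · exact ⟨hVpos.le, le_rfl⟩
  have hV : ∀ i j, |v i - v j| ≤ V := fun i j => by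
    rw [abs_le]
    constructor <;> linarith [(hv i).1, (hv i).2, (hv j).1, (hv j).2]
  obtain ⟨a, m, e, ha1, he, hcoal⟩ := exists_coalescing_jumps hN hα₀₁ hα₁₀
  have hvm : ∀ l, Measurable fun ω : ℕ → ℝ × Jump N => v (ancestor ω l a).1 := fun l =>
    (measurable_of_countable fun p : Particle N => v p.1).comp (measurable_ancestor l a)
  have hvb : ∀ l, ∀ ω : ℕ → ℝ × Jump N, |v (ancestor ω l a).1| ≤ V := fun l ω => by
    rw [abs_of_nonneg (hv _).1]
    exact (hv _).2
  have hvint := fun l => integrable_waitingTime_mul α (hvm l) (hvb l)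
  have hdint := fun l => integrable_waitingTime_mul α (measurable_defect (N := N) l)
    (abs_defect_le l)
  set c : ℕ → ℝ := fun l => ∫ ω, (ω 0).1 * v (ancestor ω l a).1 ∂P with hc
  set ε : ℕ → ℝ := fun l => ∫ ω, (ω 0).1 * defect l ω ∂P with hε
  have hε0 : Tendsto ε atTop (𝓝 0) := tendsto_integral_defect α hN hα₀₁ hα₁₀
  -- The tail of `c` is controlled by the mean defect, so `c` is Cauchy and the limit displacement
  -- per jump exists.
  have hcε : ∀ l k, l ≤ k → |c k - c l| ≤ V * ε l := by
    intro l k hlk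
    rw [hc, ← integral_sub (hvint k) (hvint l), hε, ← integral_const_mul]
    refine (abs_integral_le_integral_abs).trans
      (integral_mono_ae ((hvint k).sub (hvint l)).abs ((hdint l).const_mul V) ?_)
    filter_upwards [ae_waitingTime_nonneg α] with ω hω
    rw [← mul_sub, abs_mul, abs_of_nonneg (hω 0), mul_left_comm]
    exact mul_le_mul_of_nonneg_left (abs_sub_ancestor_le hV ω hlk a a) (hω 0)
  have hcauchy : CauchySeq c := by
    refine cauchySeq_of_le_tendsto_0 (fun l => V * ε l + V * ε l) (fun n k l hn hk => ?_) ?_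
    · rw [Real.dist_eq]
      have h1 := abs_sub_le (c n) (c l) (c k)
      rw [abs_sub_comm (c l)] at h1
      linarith [hcε l n hn, hcε l k hk]
    · simpa using (hε0.const_mul V).add (hε0.const_mul V)
  obtain ⟨c', hc'⟩ := cauchySeq_tendsto_of_complete hcauchy
  -- On `G` every ancestor over at least `m` jumps is the fast particle `a`. This bounds `c l` below
  -- by a fixed positive number for `l ≥ m`, even when `v 0 = 0`.
  set G : Set (ℕ → ℝ × Jump N) := {ω | ∀ k < m, (ω k).2 = e k} with hG
  have hGm : MeasurableSet G := by
    have : G = ⋂ k, ⋂ (_ : k < m), (fun ω : ℕ → ℝ × Jump N => (ω k).2) ⁻¹' {e k} := by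
      ext ω; simp [hG]
    rw [this]
    exact MeasurableSet.iInter fun k => MeasurableSet.iInter fun _ =>
      (measurable_snd.comp (measurable_pi_apply k)) (measurableSet_singleton _)
  have hGpos : 0 < ∫ ω, (ω 0).1 * G.indicator (fun _ => (1 : ℝ)) ω ∂P := by
    have hint := integrable_waitingTime_mul α
      ((measurable_const (a := (1 : ℝ))).indicator hGm) (C := 1) fun ω => by
        by_cases h : ω ∈ G <;> simp [h]
    have hnn : 0 ≤ᵐ[P] fun ω => (ω 0).1 * G.indicator (fun _ => (1 : ℝ)) ω := by
      filter_upwards [ae_waitingTime_nonneg α] with ω hω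
      exact mul_nonneg (hω 0) (Set.indicator_nonneg (fun _ _ => zero_le_one) _)
    rw [integral_pos_iff_support_of_nonneg_ae hnn hint]
    refine (drivingLaw_jumps_pos α he).trans_le (measure_mono_ae ?_)
    filter_upwards [ae_waitingTime_pos α] with ω hω hωG
    have hωG' : ω ∈ G := hωG
    change (ω 0).1 * G.indicator (fun _ => (1 : ℝ)) ω ≠ 0
    rw [Set.indicator_of_mem hωG', mul_one]
    exact hω.ne'
  have hc'pos : 0 < c' := by
    refine (mul_pos hVpos hGpos).trans_le (ge_of_tendsto hc' ?_)
    filter_upwards [eventually_ge_atTop m] with l hl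
    rw [hc, ← integral_const_mul]
    refine integral_mono_ae ((integrable_waitingTime_mul α
      ((measurable_const (a := (1 : ℝ))).indicator hGm) (C := 1) fun ω => by
        by_cases h : ω ∈ G <;> simp [h]).const_mul V) (hvint l) ?_
    filter_upwards [ae_waitingTime_nonneg α] with ω hω
    rw [mul_left_comm]
    refine mul_le_mul_of_nonneg_left ?_ (hω 0)
    by_cases h : ω ∈ G
    · obtain ⟨k, rfl⟩ := Nat.exists_eq_add_of_le hl
      rw [Set.indicator_of_mem h, mul_one, ancestor_add, hcoal ω h, ha1]
    · rw [Set.indicator_of_notMem h, mul_zero]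
      exact (hv _).1
  have hT : 0 < ∫ ω, (ω 0).1 ∂P := integral_waitingTime_pos α
  refine ⟨c' / ∫ ω, (ω 0).1 ∂P, div_pos hc'pos hT, ?_⟩
  have h1 := tendsto_average_waitingTime_mul (N := N) α (h := fun _ => 1) (l := 0) measurable_const
    (fun _ _ _ => rfl) (C := 1) (by simp)
  have h2 := ae_all_iff.2 fun l => tendsto_average_waitingTime_mul α
    (h := fun ω => v (ancestor ω l a).1) (l := l) (hvm l) (fun ω ω' h => by
      dsimp only
      rw [ancestor_congr fun i hi => congrArg Prod.snd (h i hi)]) (hvb l)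
  have h3 := ae_all_iff.2 fun l => tendsto_average_waitingTime_mul (N := N) α (h := defect l)
    (l := l) (measurable_defect l) (fun ω ω' h => by
      have hiff := coalesced_congr h
      by_cases hl : Coalesced ω l
      · simp [defect, hl, hiff.1 hl]
      · simp [defect, hl, mt hiff.2 hl]) (abs_defect_le l)
  filter_upwards [h1, h2, h3, ae_waitingTime_nonneg α] with ω h1 h2 h3 hω x p
  simp only [mul_one] at h1
  exact tendsto_path_div hω hT h1
    (tendsto_displacement_div hV hω a h1 h2 h3 hc' hε0 p) x

end Speed

/-! ### Uniform setwise convergence and invariant measures -/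

section UniformConvergence

variable {S : Type*} [MeasurableSpace S]

/-- By the layer cake formula, only levels in `(0, 1)` matter, so the error `c` is integrated over a
set of length one. -/
lemma lintegral_le_add_of_measure_le_add {μ ν : Measure S} [IsFiniteMeasure μ] [IsFiniteMeasure ν]
    {c : ENNReal} (h : ∀ B, MeasurableSet B → μ B ≤ ν B + c) {g : S → ENNReal}
    (hg : Measurable g) (hg1 : ∀ x, g x ≤ 1) :
    ∫⁻ x, g x ∂μ ≤ ∫⁻ x, g x ∂ν + c := by
  have hfin : ∀ x, g x ≠ ⊤ := fun x => ((hg1 x).trans_lt ENNReal.one_lt_top).ne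
  have hgr : ∀ x, g x = ENNReal.ofReal (g x).toReal := fun x =>
    (ENNReal.ofReal_toReal (hfin x)).symm
  have hlt : ∀ x (t : ℝ), t < (g x).toReal → t < 1 := fun x t ht =>
    ht.trans_le (by simpa using ENNReal.toReal_mono ENNReal.one_ne_top (hg1 x))
  have key : ∀ κ : Measure S, ∫⁻ x, g x ∂κ =
      ∫⁻ t in Set.Ioi (0 : ℝ), κ {x | t < (g x).toReal} := fun κ => by
    rw [← lintegral_eq_lintegral_meas_lt κ (ae_of_all _ fun x => ENNReal.toReal_nonneg)
      hg.ennreal_toReal.aemeasurable]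
    exact lintegral_congr hgr
  rw [key μ, key ν]
  calc ∫⁻ t in Set.Ioi (0 : ℝ), μ {x | t < (g x).toReal}
      ≤ ∫⁻ t in Set.Ioi (0 : ℝ), (ν {x | t < (g x).toReal} +
          (Set.Iio (1 : ℝ)).indicator (fun _ => c) t) := by
        refine lintegral_mono fun t => ?_
        by_cases ht : t < 1
        · simpa [ht] using h _ (measurableSet_lt measurable_const hg.ennreal_toReal)
        · have : {x | t < (g x).toReal} = ∅ := by
            ext x
            simpa using fun hx : t < (g x).toReal => ht (hlt x t hx)
          simp [this]
    _ = (∫⁻ t in Set.Ioi (0 : ℝ), ν {x | t < (g x).toReal}) + c := by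
        rw [lintegral_add_right _ (measurable_const.indicator measurableSet_Iio),
          lintegral_indicator measurableSet_Iio, Measure.restrict_restrict measurableSet_Iio]
        congr 1
        rw [setLIntegral_const, Set.inter_comm, Set.Ioi_inter_Iio, Real.volume_Ioo]
        simp

/-- A sequence of finite measures which converges uniformly on measurable sets has a limit. -/
lemma exists_measure_of_uniform_cauchy {a : ℕ → Measure S} [∀ n, IsFiniteMeasure (a n)]
    {b : ℕ → ENNReal}
    (hb : Tendsto b atTop (𝓝 0))
    (hle : ∀ n k B, n ≤ k → MeasurableSet B → a n B ≤ a k B + b n)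
    (hge : ∀ n k B, n ≤ k → MeasurableSet B → a k B ≤ a n B + b n) :
    ∃ π : Measure S, ∀ B, MeasurableSet B → Tendsto (fun n => a n B) atTop (𝓝 (π B)) := by
  let m (B : Set S) : ENNReal := liminf (fun n => a n B) atTop
  have hm1 : ∀ n B, MeasurableSet B → a n B ≤ m B + b n := fun n B hB => by
    rw [← tsub_le_iff_right]
    refine le_liminf_of_le (by isBoundedDefault) ?_
    filter_upwards [eventually_ge_atTop n] with k hk
    rw [tsub_le_iff_right]
    exact hle n k B hk hB
  have hm2 : ∀ n B, MeasurableSet B → m B ≤ a n B + b n := fun n B hB => by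
    refine liminf_le_of_frequently_le' (Eventually.frequently ?_)
    filter_upwards [eventually_ge_atTop n] with k hk
    exact hge n k B hk hB
  have hm : ∀ B, MeasurableSet B → Tendsto (fun n => a n B) atTop (𝓝 (m B)) := fun B hB => by
    refine tendsto_of_tendsto_of_tendsto_of_le_of_le (g := fun n => m B - b n)
      (h := fun n => m B + b n) ?_ ?_ (fun n => tsub_le_iff_right.2 (hm2 n B hB))
      (fun n => hm1 n B hB)
    · simpa using ENNReal.Tendsto.sub (tendsto_const_nhds (x := m B)) hb
        (Or.inr ENNReal.zero_ne_top)
    · simpa using (tendsto_const_nhds (x := m B)).add hb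
  have hm0 : m ∅ = 0 := by simp [m]
  have hsplit : ∀ B : ℕ → Set S, (∀ i, MeasurableSet (B i)) → Pairwise (Function.onFun Disjoint B) →
      ∀ k, m (⋃ i, B i) = ∑ i ∈ Finset.range k, m (B i) + m (⋃ i, B (i + k)) := by
    intro B hB hd k
    refine tendsto_nhds_unique (hm _ (MeasurableSet.iUnion hB)) ?_
    refine ((tendsto_finsetSum _ fun i _ => hm _ (hB i)).add
      (hm _ (MeasurableSet.iUnion fun i => hB (i + k)))).congr fun n => ?_
    rw [measure_iUnion hd hB, measure_iUnion (f := fun i => B (i + k))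
      (fun i j hij => hd (by omega)) fun i => hB (i + k)]
    exact ENNReal.summable.sum_add_tsum_nat_add' (f := fun i => a n (B i))
  have hadd : ∀ B : ℕ → Set S, (∀ i, MeasurableSet (B i)) → Pairwise (Function.onFun Disjoint B) →
      m (⋃ i, B i) = ∑' i, m (B i) := by
    intro B hB hd
    refine le_antisymm ?_ ?_
    -- The tail of the union is compared with the single measure `a n` at cost `b n`. For fixed `n`
    -- it vanishes as `k → ∞` by countable additivity of `a n`; then `n → ∞`.
    · have h1 : ∀ n, m (⋃ i, B i) ≤ ∑' i, m (B i) + b n := by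
        intro n
        have hR : Tendsto (fun k => a n (⋃ i, B (i + k))) atTop (𝓝 0) := by
          have h3 := ENNReal.tendsto_sum_nat_add (fun i => a n (B i))
            (by rw [← measure_iUnion hd hB]; exact measure_ne_top _ _)
          refine h3.congr fun k => ?_
          rw [measure_iUnion (f := fun i => B (i + k)) (fun i j hij => hd (by omega))
            fun i => hB (i + k)]
        have h2 : ∀ k, m (⋃ i, B i) ≤ ∑' i, m (B i) + (a n (⋃ i, B (i + k)) + b n) := fun k => by
          rw [hsplit B hB hd k]
          exact add_le_add (ENNReal.sum_le_tsum _)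
            (hm2 n _ (MeasurableSet.iUnion fun i => hB (i + k)))
        have h3 := ge_of_tendsto' ((hR.add_const (b n)).const_add (∑' i, m (B i))) h2
        rwa [zero_add] at h3
      simpa using ge_of_tendsto' (hb.const_add (∑' i, m (B i))) h1
    · refine ENNReal.tsum_le_of_sum_range_le fun k => ?_
      rw [hsplit B hB hd k]
      exact le_self_add
  refine ⟨Measure.ofMeasurable (fun B _ => m B) hm0 hadd, fun B hB => ?_⟩
  rw [Measure.ofMeasurable_apply _ hB]
  exact hm B hB

/-- A semigroup of probability kernels which forgets its initial state uniformly converges to an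
invariant probability measure. -/
lemma exists_invariant_of_uniform_forgetting [Nonempty S] {Q : ℝ≥0 → S → Measure S}
    (hprob : ∀ t x, IsProbabilityMeasure (Q t x))
    (hmeas : ∀ t B, MeasurableSet B → Measurable fun x => Q t x B)
    (hsemi : ∀ s t x B, MeasurableSet B → Q (s + t) x B = ∫⁻ y, Q t y B ∂(Q s x))
    {c : ℝ≥0 → ENNReal} (hc : Tendsto c atTop (𝓝 0))
    (hQ : ∀ t x y B, MeasurableSet B → Q t x B ≤ Q t y B + c t) :
    ∃ π : Measure S, IsProbabilityMeasure π ∧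
      (∀ t B, MeasurableSet B → ∫⁻ y, Q t y B ∂π = π B) ∧
      ∀ x B, MeasurableSet B → Tendsto (fun t => Q t x B) atTop (𝓝 (π B)) := by
  obtain ⟨x₀⟩ := ‹Nonempty S›
  have hle : ∀ t s x y B, t ≤ s → MeasurableSet B → Q t x B ≤ Q s y B + c t := by
    intro t s x y B hts hB
    obtain ⟨u, rfl⟩ := exists_add_of_le hts
    -- The extra time `u` is run first, so that the kernel at time `t` is averaged over its starting
    -- point and `hQ` applies pointwise.
    rw [add_comm t u, hsemi _ _ _ _ hB]
    have h1 : ∫⁻ z, Q t x B ∂(Q u y) ≤ ∫⁻ z, (Q t z B + c t) ∂(Q u y) :=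
      lintegral_mono fun z => hQ t x z B hB
    rwa [lintegral_add_right _ measurable_const, lintegral_const, lintegral_const, measure_univ,
      mul_one, mul_one] at h1
  have hge : ∀ t s x y B, t ≤ s → MeasurableSet B → Q s y B ≤ Q t x B + c t := by
    intro t s x y B hts hB
    obtain ⟨u, rfl⟩ := exists_add_of_le hts
    rw [add_comm t u, hsemi _ _ _ _ hB]
    have h1 : ∫⁻ z, Q t z B ∂(Q u y) ≤ ∫⁻ z, (Q t x B + c t) ∂(Q u y) :=
      lintegral_mono fun z => hQ t z x B hB
    rwa [lintegral_const, measure_univ, mul_one] at h1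
  have hnat : Tendsto (fun n : ℕ => (n : ℝ≥0)) atTop atTop := tendsto_natCast_atTop_atTop
  obtain ⟨π, hπ⟩ := exists_measure_of_uniform_cauchy (a := fun n : ℕ => Q n x₀) (hc.comp hnat)
    (fun n k B hnk hB => hle n k x₀ x₀ B (by exact_mod_cast hnk) hB)
    (fun n k B hnk hB => hge n k x₀ x₀ B (by exact_mod_cast hnk) hB)
  have hprobπ : IsProbabilityMeasure π :=
    ⟨tendsto_nhds_unique (hπ _ MeasurableSet.univ) (by simp [measure_univ])⟩
  have h1 : ∀ t x B, MeasurableSet B → Q t x B ≤ π B + c t := fun t x B hB => by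
    refine ge_of_tendsto ((hπ B hB).add_const (c t)) ?_
    filter_upwards [hnat.eventually_ge_atTop t] with n hn
    exact hle _ _ _ _ _ hn hB
  have h2 : ∀ t x B, MeasurableSet B → π B ≤ Q t x B + c t := fun t x B hB => by
    refine le_of_tendsto (hπ B hB) ?_
    filter_upwards [hnat.eventually_ge_atTop t] with n hn
    exact hge _ _ _ _ _ hn hB
  have hlim : ∀ x B, MeasurableSet B → Tendsto (fun t => Q t x B) atTop (𝓝 (π B)) := by
    intro x B hB
    refine tendsto_of_tendsto_of_tendsto_of_le_of_le (g := fun t => π B - c t)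
      (h := fun t => π B + c t) ?_ ?_ (fun t => tsub_le_iff_right.2 (h2 t x B hB))
      (fun t => h1 t x B hB)
    · simpa using ENNReal.Tendsto.sub (tendsto_const_nhds (x := π B)) hc
        (Or.inr ENNReal.zero_ne_top)
    · simpa using (tendsto_const_nhds (x := π B)).add hc
  refine ⟨π, hprobπ, fun t B hB => ?_, hlim⟩
  -- Invariance: `Q (s + t) x₀ B` tends to `π B`, while by the semigroup property it is within `c s`
  -- of the integral against `π`.
  have hshift : Tendsto (fun s => Q (s + t) x₀ B) atTop (𝓝 (π B)) :=
    (hlim x₀ B hB).comp (tendsto_atTop_mono (fun _ => le_self_add) tendsto_id)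
  refine le_antisymm ?_ ?_
  · have h3 : ∀ s, ∫⁻ y, Q t y B ∂π ≤ Q (s + t) x₀ B + c s := fun s => by
      rw [hsemi _ _ _ _ hB]
      exact lintegral_le_add_of_measure_le_add (h2 s x₀) (hmeas t B hB) fun _ => prob_le_one
    simpa using ge_of_tendsto' (hshift.add hc) h3
  · have h3 : ∀ s, Q (s + t) x₀ B ≤ ∫⁻ y, Q t y B ∂π + c s := fun s => by
      rw [hsemi _ _ _ _ hB]
      exact lintegral_le_add_of_measure_le_add (h1 s x₀) (hmeas t B hB) fun _ => prob_le_one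
    simpa using le_of_tendsto_of_tendsto' hshift (hc.const_add (∫⁻ y, Q t y B ∂π)) h3

end UniformConvergence

/-! ### Measurability of the path and restarting at the first jump -/

/-- Exactly `n` jumps happen up to time `s`. -/
def CountIs (ω : ℕ → ℝ × Jump N) (s : ℝ) (n : ℕ) : Prop :=
  s < jumpTime ω (n + 1) ∧ ∀ k < n, jumpTime ω (k + 1) ≤ s

lemma CountIs.jumpCount_eq {ω : ℕ → ℝ × Jump N} {s : ℝ} {n : ℕ} (h : CountIs ω s n) :
    jumpCount ω s = n :=
  le_antisymm (Nat.sInf_le h.1) (le_csInf ⟨n, h.1⟩ fun k hk => by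
    by_contra hlt
    exact absurd hk (not_lt.2 (h.2 k (not_le.1 hlt))))

lemma countIs_jumpCount {ω : ℕ → ℝ × Jump N} {s : ℝ} {n : ℕ} (hn : s < jumpTime ω (n + 1)) :
    CountIs ω s (jumpCount ω s) :=
  ⟨Nat.sInf_mem (s := {n : ℕ | s < jumpTime ω (n + 1)}) ⟨n, hn⟩,
    fun _ hk => not_lt.1 (Nat.notMem_of_lt_sInf hk)⟩

lemma jumpTime_seqCons (a : ℝ × Jump N) (ω : ℕ → ℝ × Jump N) (n : ℕ) :
    jumpTime (seqCons a ω) (n + 1) = a.1 + jumpTime ω n := by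
  rw [jumpTime, Finset.sum_range_succ', add_comm]
  rfl

lemma countIs_seqCons_zero (a : ℝ × Jump N) (ω : ℕ → ℝ × Jump N) (s : ℝ) :
    CountIs (seqCons a ω) s 0 ↔ s < a.1 := by
  simp [CountIs, jumpTime]

lemma countIs_seqCons_succ (a : ℝ × Jump N) (ω : ℕ → ℝ × Jump N) (s : ℝ) (n : ℕ) :
    CountIs (seqCons a ω) s (n + 1) ↔ a.1 ≤ s ∧ CountIs ω (s - a.1) n := by
  simp only [CountIs, jumpTime_seqCons]
  constructor
  · rintro ⟨h1, h2⟩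
    refine ⟨by simpa [jumpTime] using h2 0 (by omega), by linarith, fun k hk => ?_⟩
    linarith [h2 (k + 1) (by omega)]
  · rintro ⟨h0, h1, h2⟩
    refine ⟨by linarith, fun k hk => ?_⟩
    cases k with
    | zero => simpa [jumpTime] using h0
    | succ k => linarith [h2 k (by omega)]

@[fun_prop]
lemma measurable_jumpTime (n : ℕ) : Measurable fun ω : ℕ → ℝ × Jump N => jumpTime ω n := by
  unfold jumpTime
  fun_prop

lemma measurableSet_countIs (s : ℝ) (n : ℕ) :
    MeasurableSet {ω : ℕ → ℝ × Jump N | CountIs ω s n} := by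
  have : {ω : ℕ → ℝ × Jump N | CountIs ω s n} = {ω | s < jumpTime ω (n + 1)} ∩
      ⋂ k, ⋂ (_ : k < n), {ω | jumpTime ω (k + 1) ≤ s} := by
    ext ω
    simp [CountIs]
  rw [this]
  exact (measurableSet_lt measurable_const (measurable_jumpTime _)).inter
    (MeasurableSet.iInter fun k => MeasurableSet.iInter fun _ =>
      measurableSet_le (measurable_jumpTime _) measurable_const)

@[fun_prop]
lemma measurable_jumpCount (s : ℝ) : Measurable fun ω : ℕ → ℝ × Jump N => jumpCount ω s := by
  have h : ∀ n, MeasurableSet ((fun ω : ℕ → ℝ × Jump N => jumpCount ω s) ⁻¹' {n + 1}) := by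
    intro n
    have : (fun ω : ℕ → ℝ × Jump N => jumpCount ω s) ⁻¹' {n + 1} =
        {ω | CountIs ω s (n + 1)} := by
      ext ω
      refine ⟨fun hω => ?_, fun hω => hω.jumpCount_eq⟩
      have hω' : jumpCount ω s = n + 1 := hω
      have hne := Nat.nonempty_of_sInf_eq_succ hω'
      have := countIs_jumpCount hne.some_mem
      rwa [hω'] at this
    rw [this]
    exact measurableSet_countIs s _
  refine measurable_to_countable' fun n => ?_
  cases n with
  | zero =>
    have : (fun ω : ℕ → ℝ × Jump N => jumpCount ω s) ⁻¹' {0} =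
        (⋃ n, (fun ω : ℕ → ℝ × Jump N => jumpCount ω s) ⁻¹' {n + 1})ᶜ := by
      ext ω
      simp only [Set.mem_preimage, Set.mem_singleton_iff, Set.mem_compl_iff, Set.mem_iUnion,
        not_exists]
      constructor
      · intro h n; omega
      · intro h
        by_contra h0
        exact h (jumpCount ω s - 1) (by omega)
    rw [this]
    exact (MeasurableSet.iUnion h).compl
  | succ n => exact h n

@[fun_prop]
lemma measurable_applyJump : Measurable fun z : Jump N × Config N => applyJump z.1 z.2 :=
  measurable_from_prod_countable_right fun e => by
    refine measurable_pi_lambda _ fun p => ?_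
    simp only [applyJump_apply]
    exact measurable_pi_apply _

@[fun_prop]
lemma measurable_freeMotion (v : Fin 2 → ℝ) :
    Measurable fun z : ℝ × Config N => freeMotion v z.1 z.2 := by
  unfold freeMotion
  fun_prop

lemma measurable_configAfter (v : Fin 2 → ℝ) (n : ℕ) :
    Measurable fun z : Config N × (ℕ → ℝ × Jump N) => configAfter v z.1 z.2 n := by
  induction n with
  | zero => exact measurable_fst
  | succ n ih =>
    have h1 : Measurable fun z : Config N × (ℕ → ℝ × Jump N) => z.2 n := by fun_prop
    exact measurable_applyJump.comp (h1.snd.prodMk ((measurable_freeMotion v).comp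
      (h1.fst.prodMk ih)))

/-- The configuration at the real time `t`. -/
noncomputable def pathAt (v : Fin 2 → ℝ) (x : Config N) (ω : ℕ → ℝ × Jump N) (t : ℝ) : Config N :=
  freeMotion v (t - jumpTime ω (jumpCount ω t)) (configAfter v x ω (jumpCount ω t))

lemma pathAt_coe (v : Fin 2 → ℝ) (x : Config N) (ω : ℕ → ℝ × Jump N) (t : ℝ≥0) :
    pathAt v x ω t = path v x ω t := rfl

lemma measurable_pathAt (v : Fin 2 → ℝ) (t : ℝ) :
    Measurable fun z : Config N × (ℕ → ℝ × Jump N) => pathAt v z.1 z.2 t := by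
  have h : Measurable fun y : ℕ × (Config N × (ℕ → ℝ × Jump N)) =>
      freeMotion v (t - jumpTime y.2.2 y.1) (configAfter v y.2.1 y.2.2 y.1) :=
    measurable_from_prod_countable_right fun n =>
      (measurable_freeMotion v).comp ((measurable_const.sub
        ((measurable_jumpTime n).comp measurable_snd)).prodMk (measurable_configAfter v n))
  exact h.comp (((measurable_jumpCount t).comp measurable_snd).prodMk measurable_id)

lemma measurable_pathAt_right (v : Fin 2 → ℝ) (x : Config N) (t : ℝ) :
    Measurable fun ω : ℕ → ℝ × Jump N => pathAt v x ω t := by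
  have h := (measurable_pathAt v t).comp (measurable_prodMk_left (x := x))
  simpa only [Function.comp_def] using h

lemma configAfter_seqCons (v : Fin 2 → ℝ) (x : Config N) (a : ℝ × Jump N)
    (ω : ℕ → ℝ × Jump N) (n : ℕ) :
    configAfter v x (seqCons a ω) (n + 1) =
      configAfter v (applyJump a.2 (freeMotion v a.1 x)) ω n := by
  induction n with
  | zero => rfl
  | succ n ih => rw [configAfter, ih]; rfl

lemma freeMotion_freeMotion (v : Fin 2 → ℝ) (s t : ℝ) (x : Config N) :
    freeMotion v t (freeMotion v s x) = freeMotion v (s + t) x := by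
  funext p
  simp only [freeMotion]
  ring

/-- Waiting for the first jump can be restarted at time `s`. -/
lemma pathAt_seqCons_add (v : Fin 2 → ℝ) (x : Config N) (τ : ℝ) (e : Jump N)
    (ω : ℕ → ℝ × Jump N) (s t : ℝ) :
    pathAt v x (seqCons (τ, e) ω) (s + t) =
      pathAt v (freeMotion v s x) (seqCons (τ - s, e) ω) t := by
  have hcount : jumpCount (seqCons (τ, e) ω) (s + t) = jumpCount (seqCons (τ - s, e) ω) t := by
    unfold jumpCount
    congr 1
    ext n
    simp only [jumpTime_seqCons, Set.mem_ofPred_eq]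
    constructor <;> intro h <;> linarith
  rw [pathAt, pathAt, hcount]
  cases jumpCount (seqCons (τ - s, e) ω) t with
  | zero =>
    simp [configAfter, freeMotion_freeMotion, jumpTime]
  | succ n =>
    rw [configAfter_seqCons, configAfter_seqCons, freeMotion_freeMotion, jumpTime_seqCons,
      jumpTime_seqCons]
    congr 1
    · ring
    · congr 3
      ring

lemma pathAt_seqCons_of_countIs (v : Fin 2 → ℝ) (x : Config N) (a : ℝ × Jump N)
    {ω : ℕ → ℝ × Jump N} {t : ℝ} {n : ℕ} (ha : a.1 ≤ t) (h : CountIs ω (t - a.1) n) :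
    pathAt v x (seqCons a ω) t =
      pathAt v (applyJump a.2 (freeMotion v a.1 x)) ω (t - a.1) := by
  have h' := (countIs_seqCons_succ a ω t n).2 ⟨ha, h⟩
  rw [pathAt, pathAt, h'.jumpCount_eq, h.jumpCount_eq, configAfter_seqCons, jumpTime_seqCons]
  congr 1
  ring

lemma pathAt_seqCons_of_lt (v : Fin 2 → ℝ) (x : Config N) {a : ℝ × Jump N}
    (ω : ℕ → ℝ × Jump N) {t : ℝ} (ha : t < a.1) :
    pathAt v x (seqCons a ω) t = freeMotion v t x := by
  rw [pathAt, ((countIs_seqCons_zero a ω t).2 ha).jumpCount_eq]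
  simp [configAfter, jumpTime]

section Markov

variable (v : Fin 2 → ℝ) (α : Fin 2 → Fin 2 → ℝ) [hr : PositiveRates N α]

lemma ae_tendsto_jumpTime : ∀ᵐ ω ∂(drivingLaw N α), Tendsto (jumpTime ω) atTop atTop := by
  filter_upwards [tendsto_average_waitingTime_mul (N := N) α (h := fun _ => 1) (l := 0)
    measurable_const (fun _ _ _ => rfl) (C := 1) (by simp)] with ω h
  simp only [mul_one] at h
  exact tendsto_jumpTime_atTop (integral_waitingTime_pos α) h

lemma ae_countIs : ∀ᵐ ω ∂(drivingLaw N α), ∀ s, ∃ n, CountIs ω s n := by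
  filter_upwards [ae_tendsto_jumpTime α] with ω h s
  exact ⟨_, countIs_jumpCount (lt_jumpTime_jumpCount_succ h s)⟩

lemma lintegral_drivingLaw {f : (ℕ → ℝ × Jump N) → ENNReal} (hf : Measurable f) :
    ∫⁻ ω, f ω ∂(drivingLaw N α) =
      ∫⁻ a, ∫⁻ ω, f (seqCons a ω) ∂(drivingLaw N α)
        ∂((expMeasure (totalRate N α)).prod (jumpLaw N α)) :=
  lintegral_infinitePi_eq_seqCons _ hf

/-- The Markov property at time `s`, on the event that `n` jumps happen up to time `s`. -/
lemma lintegral_pathAt_add_of_countIs {f : Config N → ENNReal} (hf : Measurable f) {t : ℝ}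
    (ht : 0 ≤ t) (n : ℕ) : ∀ (s : ℝ) (_ : 0 ≤ s) (x : Config N),
      ∫⁻ ω, {ω | CountIs ω s n}.indicator (fun ω => f (pathAt v x ω (s + t))) ω
          ∂(drivingLaw N α) =
        ∫⁻ ω, {ω | CountIs ω s n}.indicator
          (fun ω => ∫⁻ ω', f (pathAt v (pathAt v x ω s) ω' t) ∂(drivingLaw N α)) ω
          ∂(drivingLaw N α) := by
  have hU : Measurable fun y => ∫⁻ ω', f (pathAt v y ω' t) ∂(drivingLaw N α) :=
    (hf.comp (measurable_pathAt v t)).lintegral_prod_right'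
  have hm1 : ∀ n s x, Measurable ({ω | CountIs ω s n}.indicator
      (fun ω => f (pathAt v x ω (s + t)))) := fun n s x =>
    (hf.comp (measurable_pathAt_right v x _)).indicator (measurableSet_countIs s n)
  have hm2 : ∀ n s x, Measurable ({ω | CountIs ω s n}.indicator
      (fun ω => ∫⁻ ω', f (pathAt v (pathAt v x ω s) ω' t) ∂(drivingLaw N α))) := fun n s x =>
    (hU.comp (measurable_pathAt_right v x _)).indicator (measurableSet_countIs s n)
  induction n with
  | zero =>
    intro s hs x
    have hH : Measurable fun a : ℝ × Jump N =>
        ∫⁻ ω, f (pathAt v (freeMotion v s x) (seqCons a ω) t) ∂(drivingLaw N α) :=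
      ((hf.comp (measurable_pathAt_right v _ t)).comp measurable_seqCons).lintegral_prod_right'
    rw [lintegral_drivingLaw α (hm1 0 s x), lintegral_drivingLaw α (hm2 0 s x)]
    have h1 : ∀ a : ℝ × Jump N, ∫⁻ ω, {ω | CountIs ω s 0}.indicator
        (fun ω => f (pathAt v x ω (s + t))) (seqCons a ω) ∂(drivingLaw N α) =
        (Set.Ioi s).indicator (fun τ => ∫⁻ ω, f (pathAt v (freeMotion v s x)
          (seqCons (τ - s, a.2) ω) t) ∂(drivingLaw N α)) a.1 := by
      intro a
      by_cases ha : s < a.1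
      · rw [Set.indicator_of_mem (Set.mem_Ioi.2 ha)]
        refine lintegral_congr fun ω => ?_
        rw [Set.indicator_of_mem (show _ ∈ {ω | CountIs ω s 0} from
          (countIs_seqCons_zero a ω s).2 ha), ← pathAt_seqCons_add]
      · rw [Set.indicator_of_notMem (by simpa using ha)]
        rw [← lintegral_zero (μ := drivingLaw N α)]
        refine lintegral_congr fun ω => ?_
        rw [Set.indicator_of_notMem]
        exact fun h => ha ((countIs_seqCons_zero a ω s).1 h)
    have h2 : ∀ a : ℝ × Jump N, ∫⁻ ω, {ω | CountIs ω s 0}.indicator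
        (fun ω => ∫⁻ ω', f (pathAt v (pathAt v x ω s) ω' t) ∂(drivingLaw N α)) (seqCons a ω)
          ∂(drivingLaw N α) =
        (Set.Ioi s).indicator (fun _ => ∫⁻ ω', f (pathAt v (freeMotion v s x) ω' t)
          ∂(drivingLaw N α)) a.1 := by
      intro a
      by_cases ha : s < a.1
      · rw [Set.indicator_of_mem (Set.mem_Ioi.2 ha)]
        rw [← mul_one (∫⁻ ω', f (pathAt v (freeMotion v s x) ω' t) ∂(drivingLaw N α)),
          ← measure_univ (μ := drivingLaw N α), ← lintegral_const]
        refine lintegral_congr fun ω => ?_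
        rw [Set.indicator_of_mem (show _ ∈ {ω | CountIs ω s 0} from
          (countIs_seqCons_zero a ω s).2 ha), pathAt_seqCons_of_lt v x ω ha]
      · rw [Set.indicator_of_notMem (by simpa using ha)]
        rw [← lintegral_zero (μ := drivingLaw N α)]
        refine lintegral_congr fun ω => ?_
        rw [Set.indicator_of_notMem]
        exact fun h => ha ((countIs_seqCons_zero a ω s).1 h)
    simp_rw [h1, h2]
    have hH' : ∀ e, Measurable fun τ => ∫⁻ ω, f (pathAt v (freeMotion v s x)
        (seqCons (τ, e) ω) t) ∂(drivingLaw N α) := fun e =>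
      hH.comp (measurable_id.prodMk measurable_const)
    rw [lintegral_prod_symm _ ?_, lintegral_prod_symm _ ?_]
    · simp_rw [lintegral_indicator measurableSet_Ioi,
        lintegral_expMeasure_Ioi hs (hH' _)]
      rw [lintegral_const_mul _ hH.lintegral_prod_left', ← lintegral_prod_symm _ hH.aemeasurable,
        ← lintegral_drivingLaw α (f := fun ω => f (pathAt v (freeMotion v s x) ω t))
          (hf.comp (measurable_pathAt_right v _ t)), lintegral_const, lintegral_const,
        Measure.restrict_apply_univ, expMeasure_Ioi hr.totalRate_pos hs, measure_univ, mul_one,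
        mul_comm]
    · exact ((measurable_const.indicator measurableSet_Ioi).comp measurable_fst).aemeasurable
    · have : (fun a : ℝ × Jump N => (Set.Ioi s).indicator (fun τ => ∫⁻ ω, f (pathAt v
          (freeMotion v s x) (seqCons (τ - s, a.2) ω) t) ∂(drivingLaw N α)) a.1) =
          (Prod.fst ⁻¹' Set.Ioi s).indicator (fun a : ℝ × Jump N => ∫⁻ ω, f (pathAt v
          (freeMotion v s x) (seqCons (a.1 - s, a.2) ω) t) ∂(drivingLaw N α)) := by
        funext a
        by_cases ha : s < a.1
        · rw [Set.indicator_of_mem (Set.mem_Ioi.2 ha), Set.indicator_of_mem (by simpa using ha)]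
        · rw [Set.indicator_of_notMem (by simpa using ha),
            Set.indicator_of_notMem (by simpa using ha)]
      rw [this]
      exact ((hH.comp ((measurable_fst.sub_const s).prodMk measurable_snd)).indicator
        (measurable_fst measurableSet_Ioi)).aemeasurable
  | succ n ih =>
    intro s hs x
    rw [lintegral_drivingLaw α (hm1 (n + 1) s x), lintegral_drivingLaw α (hm2 (n + 1) s x)]
    have hnn : ∀ᵐ a ∂((expMeasure (totalRate N α)).prod (jumpLaw N α)), 0 ≤ a.1 :=
      Measure.quasiMeasurePreserving_fst.ae (ae_nonneg_expMeasure _)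
    refine lintegral_congr_ae ?_
    filter_upwards [hnn] with a ha0
    by_cases ha : a.1 ≤ s
    · have := ih (s - a.1) (by linarith) (applyJump a.2 (freeMotion v a.1 x))
      refine Eq.trans ?_ (this.trans ?_)
      · refine lintegral_congr_ae ?_
        filter_upwards [ae_countIs α] with ω hω
        by_cases h : CountIs ω (s - a.1) n
        · obtain ⟨k, hk⟩ := hω (s + t - a.1)
          rw [Set.indicator_of_mem (show seqCons a ω ∈ {ω | CountIs ω s (n + 1)} from
            (countIs_seqCons_succ a ω s n).2 ⟨ha, h⟩), Set.indicator_of_mem (show ω ∈ _ from h),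
            pathAt_seqCons_of_countIs v x a (by linarith) hk]
          congr 2
          ring
        · rw [Set.indicator_of_notMem, Set.indicator_of_notMem]
          · exact h
          · exact fun h' => h ((countIs_seqCons_succ a ω s n).1 h').2
      · refine lintegral_congr fun ω => ?_
        by_cases h : CountIs ω (s - a.1) n
        · rw [Set.indicator_of_mem (show seqCons a ω ∈ {ω | CountIs ω s (n + 1)} from
            (countIs_seqCons_succ a ω s n).2 ⟨ha, h⟩), Set.indicator_of_mem (show ω ∈ _ from h),
            pathAt_seqCons_of_countIs v x a ha h]
        · rw [Set.indicator_of_notMem, Set.indicator_of_notMem]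
          · exact fun h' => h ((countIs_seqCons_succ a ω s n).1 h').2
          · exact h
    · refine lintegral_congr fun ω => ?_
      have h : seqCons a ω ∉ {ω | CountIs ω s (n + 1)} := fun h =>
        ha ((countIs_seqCons_succ a ω s n).1 h).1
      rw [Set.indicator_of_notMem h, Set.indicator_of_notMem h]

lemma lintegral_eq_tsum_countIs (s : ℝ) {g : (ℕ → ℝ × Jump N) → ENNReal} (hg : Measurable g) :
    ∫⁻ ω, g ω ∂(drivingLaw N α) =
      ∑' n, ∫⁻ ω, {ω | CountIs ω s n}.indicator g ω ∂(drivingLaw N α) := by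
  rw [← lintegral_tsum fun n => (hg.indicator (measurableSet_countIs s n)).aemeasurable]
  refine lintegral_congr_ae ?_
  filter_upwards [ae_countIs α] with ω hω
  obtain ⟨n, hn⟩ := hω s
  have h : ∀ m ≠ n, {ω | CountIs ω s m}.indicator g ω = 0 := fun m hm =>
    Set.indicator_of_notMem (s := {ω | CountIs ω s m}) (fun h =>
      hm ((show CountIs ω s m from h).jumpCount_eq.symm.trans hn.jumpCount_eq)) _
  rw [tsum_eq_single n h, Set.indicator_of_mem (show ω ∈ {ω | CountIs ω s n} from hn)]

/-- The Markov property of the particle process. -/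
lemma lintegral_path_add {f : Config N → ENNReal} (hf : Measurable f) (s t : ℝ≥0)
    (x : Config N) :
    ∫⁻ ω, f (path v x ω (s + t)) ∂(drivingLaw N α) =
      ∫⁻ ω, ∫⁻ ω', f (path v (path v x ω s) ω' t) ∂(drivingLaw N α) ∂(drivingLaw N α) := by
  simp_rw [← pathAt_coe, NNReal.coe_add]
  have h1 : Measurable fun ω => f (pathAt v x ω (s + t)) :=
    hf.comp (measurable_pathAt_right v x _)
  have h2 : Measurable fun y => ∫⁻ ω', f (pathAt v y ω' t) ∂(drivingLaw N α) :=
    (hf.comp (measurable_pathAt v t)).lintegral_prod_right'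
  have h3 : Measurable fun ω => ∫⁻ ω', f (pathAt v (pathAt v x ω s) ω' t) ∂(drivingLaw N α) :=
    h2.comp (measurable_pathAt_right v x s)
  rw [lintegral_eq_tsum_countIs α s h1, lintegral_eq_tsum_countIs α s h3]
  exact tsum_congr fun n => lintegral_pathAt_add_of_countIs v α hf t.2 n s s.2 x

end Markov

@[fun_prop]
lemma measurable_fromLeftmost : Measurable (fromLeftmost : Config N → Config N) :=
  measurable_pi_lambda _ fun p =>
    (measurable_pi_apply p).sub (Measurable.iInf fun q => measurable_pi_apply q)

lemma fromLeftmost_add_const (x : Config N) (c : ℝ) :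
    fromLeftmost (fun p => x p + c) = fromLeftmost x := by
  funext p
  have : Nonempty (Particle N) := ⟨p⟩
  simp only [fromLeftmost]
  rw [← ciInf_add (Set.finite_range x).bddBelow c]
  ring

lemma path_apply (v : Fin 2 → ℝ) (x : Config N) (ω : ℕ → ℝ × Jump N) (t : ℝ≥0)
    (p : Particle N) :
    path v x ω t p = x (ancestor ω (jumpCount ω t) p) + (displacement v ω (jumpCount ω t) p +
      v p.1 * (t - jumpTime ω (jumpCount ω t))) := by
  rw [path, freeMotion, configAfter_eq, add_assoc]

lemma fromLeftmost_path_fromLeftmost (v : Fin 2 → ℝ) (x : Config N) (ω : ℕ → ℝ × Jump N)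
    (t : ℝ≥0) :
    fromLeftmost (path v (fromLeftmost x) ω t) = fromLeftmost (path v x ω t) := by
  rw [← fromLeftmost_add_const (path v x ω t) (-⨅ q, x q)]
  congr 1
  funext p
  rw [path_apply, path_apply, fromLeftmost]
  ring

lemma fromLeftmost_path_congr (v : Fin 2 → ℝ) (x y : Config N) {ω : ℕ → ℝ × Jump N}
    {t : ℝ≥0} (h : Coalesced ω (jumpCount ω t)) :
    fromLeftmost (path v x ω t) = fromLeftmost (path v y ω t) := by
  rcases isEmpty_or_nonempty (Particle N) with _ | ⟨⟨q⟩⟩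
  · exact Subsingleton.elim _ _
  rw [← fromLeftmost_add_const (path v y ω t)
    (x (ancestor ω (jumpCount ω t) q) - y (ancestor ω (jumpCount ω t) q))]
  congr 1
  funext p
  rw [path_apply, path_apply, h p q]
  ring

lemma measurable_path (v : Fin 2 → ℝ) (t : ℝ≥0) :
    Measurable fun z : Config N × (ℕ → ℝ × Jump N) => path v z.1 z.2 t :=
  measurable_pathAt v t

lemma measurable_fromLeftmost_path (v : Fin 2 → ℝ) (x : Config N) (t : ℝ≥0) :
    Measurable fun ω : ℕ → ℝ × Jump N => fromLeftmost (path v x ω t) :=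
  measurable_fromLeftmost.comp (measurable_pathAt_right v x t)

section Semigroup

variable (v : Fin 2 → ℝ) (α : Fin 2 → Fin 2 → ℝ)

/-- The law at time `t` of the configuration seen from the leftmost particle. -/
noncomputable def leftmostLaw (t : ℝ≥0) (x : Config N) : Measure (Config N) :=
  (drivingLaw N α).map fun ω => fromLeftmost (path v x ω t)

lemma leftmostLaw_apply (t : ℝ≥0) (x : Config N) {B : Set (Config N)} (hB : MeasurableSet B) :
    leftmostLaw v α t x B = drivingLaw N α {ω | fromLeftmost (path v x ω t) ∈ B} :=
  Measure.map_apply (measurable_fromLeftmost_path v x t) hB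

variable [hr : PositiveRates N α]

lemma measurable_leftmostLaw_apply (t : ℝ≥0) {B : Set (Config N)} (hB : MeasurableSet B) :
    Measurable fun x => leftmostLaw v α t x B := by
  simp_rw [leftmostLaw_apply v α t _ hB]
  exact measurable_measure_prodMk_left ((measurable_fromLeftmost.comp (measurable_path v t)) hB)

lemma leftmostLaw_add (s t : ℝ≥0) (x : Config N) {B : Set (Config N)} (hB : MeasurableSet B) :
    leftmostLaw v α (s + t) x B = ∫⁻ y, leftmostLaw v α t y B ∂(leftmostLaw v α s x) := by
  have hf : Measurable fun y : Config N => B.indicator (1 : Config N → ENNReal) (fromLeftmost y) :=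
    (measurable_one.indicator hB).comp measurable_fromLeftmost
  have key : ∀ u y, leftmostLaw v α u y B =
      ∫⁻ ω, B.indicator (1 : Config N → ENNReal) (fromLeftmost (path v y ω u))
        ∂(drivingLaw N α) := by
    intro u y
    rw [← lintegral_indicator_one hB, leftmostLaw, lintegral_map (measurable_one.indicator hB)
      (measurable_fromLeftmost_path v y u)]
  rw [key, lintegral_path_add v α hf]
  conv_rhs => rw [leftmostLaw]
  rw [lintegral_map (measurable_leftmostLaw_apply v α t hB)
    (measurable_fromLeftmost_path v x s)]
  refine lintegral_congr fun ω => ?_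
  rw [key]
  simp_rw [fromLeftmost_path_fromLeftmost]

lemma measurableSet_coalesced_jumpCount (t : ℝ) :
    MeasurableSet {ω : ℕ → ℝ × Jump N | Coalesced ω (jumpCount ω t)} := by
  have : {ω : ℕ → ℝ × Jump N | Coalesced ω (jumpCount ω t)} =
      ⋃ n, {ω | Coalesced ω n} ∩ (fun ω => jumpCount ω t) ⁻¹' {n} := by
    ext ω
    simp
  rw [this]
  exact MeasurableSet.iUnion fun n => (measurableSet_coalesced n).inter
    (measurable_jumpCount t (measurableSet_singleton n))

lemma tendsto_not_coalesced_jumpCount (hN : ∀ i, 0 < N i) (hα₀₁ : 0 < α 0 1)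
    (hα₁₀ : 0 < α 1 0) :
    Tendsto (fun t : ℝ≥0 => drivingLaw N α {ω | ¬ Coalesced ω (jumpCount ω t)}) atTop (𝓝 0) := by
  have hm : ∀ t : ℝ≥0, MeasurableSet {ω : ℕ → ℝ × Jump N | ¬ Coalesced ω (jumpCount ω t)} :=
    fun t => (measurableSet_coalesced_jumpCount t).compl
  simp_rw [← fun t : ℝ≥0 => lintegral_indicator_one (μ := drivingLaw N α) (hm t)]
  have h := tendsto_lintegral_filter_of_dominated_convergence (μ := drivingLaw N α)
    (l := (atTop : Filter ℝ≥0))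
    (F := fun t => {ω | ¬ Coalesced ω (jumpCount ω t)}.indicator 1) (f := fun _ => 0) (fun _ => 1)
    (Eventually.of_forall fun t => measurable_one.indicator (hm t))
    (Eventually.of_forall fun t => ae_of_all _ fun ω =>
      Set.indicator_le_self' (fun _ _ => zero_le_one) ω) (by simp) ?_
  · simpa using h
  · filter_upwards [ae_exists_coalesced α hN hα₀₁ hα₁₀, ae_tendsto_jumpTime α,
      ae_waitingTime_nonneg α] with ω ⟨n, hn⟩ hT hω
    have hcount : Tendsto (fun t : ℝ≥0 => jumpCount ω t) atTop atTop :=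
      (tendsto_jumpCount hω hT).comp (NNReal.tendsto_coe_atTop.2 tendsto_id)
    refine tendsto_const_nhds.congr' ?_
    filter_upwards [hcount.eventually_ge_atTop n] with t ht
    exact (Set.indicator_of_notMem (s := {ω | ¬ Coalesced ω (jumpCount ω t)})
      (fun h => h (hn.mono ht)) _).symm

/-- The process seen from the leftmost particle has a stationary distribution, to which its laws
converge. -/
lemma exists_stationary (hN : ∀ i, 0 < N i) (hα₀₁ : 0 < α 0 1) (hα₁₀ : 0 < α 1 0) :
    ∃ π : ProbabilityMeasure (Config N), IsStationaryFromLeftmost v α (π : Measure (Config N)) ∧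
      ∀ x B, MeasurableSet B →
        Tendsto (fun t => leftmostLaw v α t x B) atTop (𝓝 ((π : Measure (Config N)) B)) := by
  obtain ⟨π, hπ, hinv, hlim⟩ := exists_invariant_of_uniform_forgetting
    (Q := leftmostLaw (N := N) v α)
    (fun t x => Measure.isProbabilityMeasure_map
      (measurable_fromLeftmost_path v x t).aemeasurable)
    (fun t B hB => measurable_leftmostLaw_apply v α t hB)
    (fun s t x B hB => leftmostLaw_add v α s t x hB)
    (tendsto_not_coalesced_jumpCount α hN hα₀₁ hα₁₀)
    (fun t x y B hB => by
      rw [leftmostLaw_apply v α t x hB, leftmostLaw_apply v α t y hB]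
      refine (measure_mono fun ω hω => ?_).trans (measure_union_le _ _)
      by_cases h : Coalesced ω (jumpCount ω t)
      · refine Or.inl ?_
        rwa [Set.mem_ofPred_eq, ← fromLeftmost_path_congr v x y h]
      · exact Or.inr h)
  refine ⟨⟨π, hπ⟩, fun t => ?_, hlim⟩
  ext B hB
  have hm : Measurable fun z : Config N × (ℕ → ℝ × Jump N) => fromLeftmost (path v z.1 z.2 t) :=
    measurable_fromLeftmost.comp (measurable_path v t)
  rw [Measure.map_apply hm hB]
  refine (Measure.prod_apply (hm hB)).trans (Eq.trans ?_ (hinv t B hB))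
  exact lintegral_congr fun x => (leftmostLaw_apply v α t x hB).symm

end Semigroup

section Transfer

variable {Ω : Type*} [MeasurableSpace Ω] {μ : Measure Ω} {v : Fin 2 → ℝ} {α : Fin 2 → Fin 2 → ℝ}
  {x : Config N} {X : ℝ≥0 → Ω → Config N}

/-- The existence of the limit `w` of the averaged trajectory `f p`, tested at rational times. -/
def HasRationalSpeed (w : ℝ) (p : Particle N) (f : ℝ≥0 → Config N) : Prop :=
  ∀ n : ℕ, ∃ m : ℕ, ∀ q : ℚ, m ≤ Real.toNNReal q →
    |f (Real.toNNReal q) p / (Real.toNNReal q : ℝ) - w| ≤ 1 / ((n : ℝ) + 1)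

lemma measurableSet_hasRationalSpeed (w : ℝ) (p : Particle N) :
    MeasurableSet {f : ℝ≥0 → Config N | HasRationalSpeed w p f} := by
  simp only [HasRationalSpeed, Set.ofPred_forall, Set.ofPred_exists]
  refine MeasurableSet.iInter fun n => MeasurableSet.iUnion fun m => MeasurableSet.iInter fun q =>
    MeasurableSet.iInter fun _ => measurableSet_le ?_ measurable_const
  have h : Measurable fun f : ℝ≥0 → Config N => f (Real.toNNReal q) p :=
    (measurable_pi_apply p).comp (measurable_pi_apply (Real.toNNReal q))
  exact ((h.div_const _).sub_const w).abs

lemma hasRationalSpeed_of_tendsto {w : ℝ} {p : Particle N} {f : ℝ≥0 → Config N}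
    (h : Tendsto (fun t : ℝ≥0 => f t p / (t : ℝ)) atTop (𝓝 w)) : HasRationalSpeed w p f := by
  intro n
  have h1 := h.eventually (Metric.closedBall_mem_nhds w (ε := 1 / ((n : ℝ) + 1)) (by positivity))
  obtain ⟨t, ht⟩ := eventually_atTop.1 h1
  obtain ⟨m, hm⟩ := exists_nat_ge t
  exact ⟨m, fun q hq => ht _ (hm.trans hq)⟩

lemma HasRationalSpeed.tendsto {w : ℝ} {p : Particle N} {f : ℝ≥0 → Config N}
    (h : HasRationalSpeed w p f)
    (hf : ∀ t : ℝ≥0, ContinuousWithinAt f (Set.Ici t) t) :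
    Tendsto (fun t : ℝ≥0 => f t p / (t : ℝ)) atTop (𝓝 w) := by
  rw [Metric.tendsto_atTop]
  intro ε hε
  obtain ⟨n, hn⟩ := exists_nat_one_div_lt hε
  obtain ⟨m, hm⟩ := h n
  refine ⟨m + 1, fun t ht => lt_of_le_of_lt ?_ hn⟩
  have ht0 : t ≠ 0 := fun h0 => by
    have : (1 : ℝ≥0) ≤ 0 := (le_add_self.trans ht).trans h0.le
    exact absurd this (by simp)
  have hcont : Tendsto (fun s : ℝ≥0 => f s p / (s : ℝ)) (𝓝[>] t) (𝓝 (f t p / (t : ℝ))) := by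
    have h1 : Tendsto (fun s => f s p) (𝓝[>] t) (𝓝 (f t p)) :=
      ((continuous_apply p).tendsto _).comp
        ((hf t).mono_left (nhdsWithin_mono t Set.Ioi_subset_Ici_self))
    refine h1.div ?_ (by exact_mod_cast ht0)
    exact (NNReal.continuous_coe.tendsto t).mono_left nhdsWithin_le_nhds
  have hfreq : ∃ᶠ s in 𝓝[>] t, f s p / (s : ℝ) ∈ Metric.closedBall w (1 / ((n : ℝ) + 1)) := by
    rw [Filter.frequently_iff]
    intro U hU
    obtain ⟨u, hu, hsub⟩ := (mem_nhdsGT_iff_exists_Ioo_subset' (lt_add_one t)).1 hU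
    obtain ⟨q, _, hq1, hq2⟩ := NNReal.lt_iff_exists_rat_btwn t u |>.1 hu
    exact ⟨_, hsub ⟨hq1, hq2⟩, hm q ((le_self_add.trans ht).trans hq1.le)⟩
  exact Metric.isClosed_closedBall.mem_of_frequently_of_tendsto hfreq hcont

lemma IsParticleProcess.ae_tendsto_div (h : IsParticleProcess v α x X μ) {w : ℝ} {p : Particle N}
    (hw : ∀ᵐ ω ∂(drivingLaw N α),
      Tendsto (fun t : ℝ≥0 => path v x ω t p / (t : ℝ)) atTop (𝓝 w)) :
    ∀ᵐ ω ∂μ, Tendsto (fun t : ℝ≥0 => X t ω p / (t : ℝ)) atTop (𝓝 w) := by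
  have h1 := h.identDistrib.symm.ae_snd (measurableSet_hasRationalSpeed w p)
    (hw.mono fun ω hω => hasRationalSpeed_of_tendsto (f := fun t => path v x ω t) hω)
  filter_upwards [h1, h.rightContinuous] with ω h1 h2
  exact HasRationalSpeed.tendsto h1 h2

lemma measurable_fromLeftmost_eval (t : ℝ≥0) :
    Measurable fun f : ℝ≥0 → Config N => fromLeftmost (f t) :=
  measurable_fromLeftmost.comp (measurable_pi_apply t)

lemma IsParticleProcess.aemeasurable (h : IsParticleProcess v α x X μ) (t : ℝ≥0) :
    AEMeasurable (fun ω => fromLeftmost (X t ω)) μ :=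
  (measurable_fromLeftmost_eval t).comp_aemeasurable h.identDistrib.aemeasurable_fst

lemma IsParticleProcess.map_fromLeftmost (h : IsParticleProcess v α x X μ) (t : ℝ≥0) :
    μ.map (fun ω => fromLeftmost (X t ω)) = leftmostLaw v α t x :=
  (h.identDistrib.comp (measurable_fromLeftmost_eval t)).map_eq

lemma IsParticleProcess.tendstoInDistribution [IsProbabilityMeasure μ]
    (h : IsParticleProcess v α x X μ) {π : ProbabilityMeasure (Config N)}
    (hπ : ∀ B, MeasurableSet B →
      Tendsto (fun t => leftmostLaw v α t x B) atTop (𝓝 ((π : Measure (Config N)) B))) :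
    TendstoInDistribution (fun (t : ℝ≥0) ω => fromLeftmost (X t ω)) atTop
      id (fun _ => μ) (π : Measure (Config N)) where
  forall_aemeasurable := h.aemeasurable
  aemeasurable_limit := aemeasurable_id
  tendsto := by
    refine tendsto_of_forall_isOpen_le_liminf' fun G hG => ?_
    simp only [ProbabilityMeasure.coe_mk, h.map_fromLeftmost, Measure.map_id]
    exact (hπ G hG.measurableSet).liminf_eq.ge

end Transfer

end SyncModel

theorem theoremt (N : Fin 2 → ℕ) (hN : ∀ i, 0 < N i)
    (v : Fin 2 → ℝ) (hv₀ : 0 ≤ v 0) (hv₁ : v 0 < v 1)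
    (α : Fin 2 → Fin 2 → ℝ) (hα : ∀ i j, 0 ≤ α i j) (hα₀₁ : 0 < α 0 1) (hα₁₀ : 0 < α 1 0) :
    ∃ (w : ℝ) (π : ProbabilityMeasure (SyncModel.Config N)),
      0 < w ∧
      SyncModel.IsStationaryFromLeftmost v α (π : Measure (SyncModel.Config N)) ∧
      ∀ (Ω : Type*) [MeasurableSpace Ω] (μ : Measure Ω) [IsProbabilityMeasure μ]
        (x : SyncModel.Config N) (X : ℝ≥0 → Ω → SyncModel.Config N),
        SyncModel.IsParticleProcess v α x X μ →
          (∀ (i : Fin 2) (k : Fin (N i)),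
            ∀ᵐ ω ∂μ, Tendsto (fun t : ℝ≥0 => X t ω ⟨i, k⟩ / (t : ℝ)) atTop (𝓝 w)) ∧
          TendstoInDistribution (fun (t : ℝ≥0) ω => SyncModel.fromLeftmost (X t ω)) atTop
            id (fun _ => μ) (π : Measure (SyncModel.Config N)) := by
  have hr : SyncModel.PositiveRates N α := SyncModel.PositiveRates.of_jumpRate_pos hα
    (⟨0, ⟨0, hN 0⟩⟩, ⟨1, ⟨0, hN 1⟩⟩) (div_pos hα₀₁ (by exact_mod_cast hN 1))
  obtain ⟨w, hw, hspeed⟩ := SyncModel.exists_speed v α hN hv₀ hv₁ hα₀₁ hα₁₀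
  obtain ⟨π, hstat, hlim⟩ := SyncModel.exists_stationary v α hN hα₀₁ hα₁₀
  refine ⟨w, π, hw, hstat, fun Ω _ μ _ x X hX => ⟨fun i k => ?_, ?_⟩⟩
  · exact hX.ae_tendsto_div (hspeed.mono fun ω hω => hω x ⟨i, k⟩)
  · exact hX.tendstoInDistribution (hlim x)
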